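/- Let $d\ge 1$, let $v\in\mathbb{R}^d$ have positive entries, $\|x\|_v=\sqrt{\sum_i v_i x_i^2}$, and let $H:\mathbb{R}^d\to\mathbb{R}^d$ satisfy $\|H(x)-H(y)\|_v\le\gamma\|x-y\|_v$ for all $x,y$, for some $\gamma\in[0,1)$. Let $p>1$, $\alpha,K>0$. Then: (i) $H$ has a unique fixed point $x^\star$. (ii) The function $\Phi(x)=\|x\|_v^2$ is a Lyapunov function with drift constant $\eta=1-\gamma^2>0$. That is, $\Phi$ is nonnegative and differentiable, and there are constants $c_1,c_2,L>0$ such that for all $x,y\in\mathbb{R}^d$ $$\langle\nabla\Phi(x-x^\star),H(x)-x\rangle\le-(1-\gamma^2)\,\Phi(x-x^\star),$$ $$\Phi(y)\le\Phi(x)+\langle\nabla\Phi(x),y-x\rangle+\tfrac L2\|y-x\|_2^2,$$ $$c_1\|x-x^\star\|_2^2\le\Phi(x-x^\star)\le c_2\|x-x^\star\|_2^2.$$ (iii) For every $\xi\in\mathbb{R}$, put $\alpha_k=\alpha(k+K)^{-\xi}$. Then the following are equivalent: - $\xi\in(1/p,1]$; - for every probability space and all random sequences $(x_k)_{k\ge0}$,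 $(w_k)_{k\ge0}$ in $\mathbb{R}^d$ on it with $$x_{k+1}=x_k+\alpha_k\,(H(x_k)-x_k+w_k)\qquad(k\ge0)$$ such that, with $\mathcal F_k=\sigma(x_0,\dots,x_k)$, every $w_k$ is integrable with $\mathbb{E}[w_k\mid\mathcal F_k]=0$, and there are constants $A_p>0$, $B_p\ge0$ with $\mathbb{E}[\|w_k\|_2^p\mid\mathcal F_k]\le A_p+B_p\|x_k-x^\star\|_2^p$ almost surely for all $k\ge0$, one has $x_k\to x^\star$ almost surely. -/

import Mathlib

open MeasureTheory ProbabilityTheory Filter Topology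
open scoped ENNReal

universe u

noncomputable section

/-- The weighted Euclidean norm `‖x‖_v = √(∑ i, v i * x i ^ 2)` on `ℝ^d`. -/
def weightedNorm {d : ℕ} (v : Fin d → ℝ) (x : EuclideanSpace ℝ (Fin d)) : ℝ :=
  √(∑ i, v i * x i ^ 2)

/-- `H` is a contraction of `ℝ^d` with constant `γ ∈ [0, 1)` in the norm `‖·‖_v`. -/
structure IsWeightedContraction {d : ℕ} (v : Fin d → ℝ) (γ : ℝ)
    (H : EuclideanSpace ℝ (Fin d) → EuclideanSpace ℝ (Fin d)) : Prop where
  nonneg : 0 ≤ γ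
  lt_one : γ < 1
  contract : ∀ x y, weightedNorm v (H x - H y) ≤ γ * weightedNorm v (x - y)

/-- The negative drift condition for the operator `H` at the point `xstar`: the function `Φ` is a
nonnegative differentiable Lyapunov function with drift constant `η > 0`, it is smooth (quadratic
upper bound), and it is comparable to the squared Euclidean norm. -/
structure NegativeDrift {d : ℕ} (H : EuclideanSpace ℝ (Fin d) → EuclideanSpace ℝ (Fin d))
    (xstar : EuclideanSpace ℝ (Fin d)) (Φ : EuclideanSpace ℝ (Fin d) → ℝ) (η : ℝ) : Prop where
  nonneg : ∀ x, 0 ≤ Φ x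
  differentiable : Differentiable ℝ Φ
  rate_pos : 0 < η
  drift : ∀ x, inner ℝ (gradient Φ (x - xstar)) (H x - x) ≤ -η * Φ (x - xstar)
  smooth : ∃ L : ℝ, 0 < L ∧
    ∀ x y, Φ y ≤ Φ x + inner ℝ (gradient Φ x) (y - x) + L / 2 * ‖y - x‖ ^ 2
  sandwich : ∃ c₁ c₂ : ℝ, 0 < c₁ ∧ 0 < c₂ ∧
    ∀ x, c₁ * ‖x - xstar‖ ^ 2 ≤ Φ (x - xstar) ∧ Φ (x - xstar) ≤ c₂ * ‖x - xstar‖ ^ 2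

/-- Unbiased noise: every `w k` is integrable and `E[w k | ℱ k] = 0` almost surely. -/
def UnbiasedNoise {Ω : Type*} [MeasurableSpace Ω] {d : ℕ} (μ : Measure Ω)
    (ℱ : Filtration ℕ ‹MeasurableSpace Ω›) (w : ℕ → Ω → EuclideanSpace ℝ (Fin d)) : Prop :=
  ∀ k, Integrable (w k) μ ∧ μ[w k | ℱ k] =ᵐ[μ] 0

/-- The `p`-th moment noise growth condition: there are constants `A > 0`, `B ≥ 0` such that
`E[‖w k‖ ^ p | ℱ k] ≤ A + B * ‖x k - xstar‖ ^ p` almost surely, for all `k`. The conditional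
expectation is that of a nonnegative function, so that no integrability is presupposed. -/
def MomentNoise {Ω : Type*} [MeasurableSpace Ω] {d : ℕ} (μ : Measure Ω)
    (ℱ : Filtration ℕ ‹MeasurableSpace Ω›) (p : ℝ) (xstar : EuclideanSpace ℝ (Fin d))
    (x w : ℕ → Ω → EuclideanSpace ℝ (Fin d)) : Prop :=
  ∃ A B : ℝ, 0 < A ∧ 0 ≤ B ∧ ∀ k,
    condLExp (ℱ k) μ (fun ω => ENNReal.ofReal (‖w k ω‖ ^ p)) ≤ᵐ[μ]
      fun ω => ENNReal.ofReal (A + B * ‖x k ω - xstar‖ ^ p)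

/-- `x` follows the stochastic approximation recursion for the operator `H` with step sizes `a`
and noise `w`. -/
def IsStochasticApproximation {Ω : Type*} {d : ℕ}
    (H : EuclideanSpace ℝ (Fin d) → EuclideanSpace ℝ (Fin d)) (a : ℕ → ℝ)
    (x w : ℕ → Ω → EuclideanSpace ℝ (Fin d)) : Prop :=
  ∀ k ω, x (k + 1) ω = x k ω + a k • (H (x k ω) - x k ω + w k ω)

end

/-! Rescaling the coordinates by `√(v i)` turns `‖·‖_v` into the Euclidean norm. The fixed point is
then Banach's, and the drift inequality is `2⟪a, b⟫ ≤ ‖a‖² + ‖b‖²` together with the contraction.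

Sufficiency of `1/p < ξ ≤ 1`. The noise may lack second moments, and the squared steps may fail to
be summable, so `Φ` itself is not followed. Truncate instead at `α_k ‖w_k‖ ≤ (1 + ‖x_k‖) θ_k` with
`θ_k = α_k ^ κ`. If `κ = 1 - ρ/p` with `1/ξ < ρ < p`, then `(α_k/θ_k)^p = α_k^ρ` is summable, and by
Borel–Cantelli the truncation is almost surely active only finitely often
(`ae_eventually_noise_le`). For the truncated process a high power `‖x_k‖^(2n+2)` contracts by a
factor `1 - c α_k/2` in mean, up to an error of order `α_k θ_k^(n+1)`
(`exists_setIntegral_truncPow_succ_le`), which is summable for large `n`. A Robbins–Siegmund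
argument (`ae_tendsto_zero_of_setIntegral_succ_le`) concludes, because `∑ α_k = ∞` when `ξ ≤ 1`. The
truncated noise is never recentred: the process is set to `0` once the level is exceeded, and the
linear term lost there is paid for by the `p`-th moment.

Necessity. For `0 ≤ ξ ≤ 1/p`, independent jumps of size `b/α_k` with probability `(α_k/b)^p` occur
infinitely often, and each moves the iterate by `b`. For `ξ > 1` the steps are summable, so the
effect of one kick is never undone. For `ξ < 0` the steps become so large that the noiseless
recursion overshoots and does not approach the fixed point. -/

/-! ### Elementary inequalities for even powers -/

/-- A first-order expansion whose remainder carries a factor `B`. It is meant for `A = ‖a‖²`, `B =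
‖α w‖²`, `t = α⟪a, w⟫`, so that the base on the left is `‖a + α w‖²` and the term linear in `t` has
mean zero. -/
theorem exists_add_pow_succ_le (n : ℕ) : ∃ C : ℝ, 0 ≤ C ∧ ∀ A B t : ℝ, 0 ≤ A → 0 ≤ B →
    t ^ 2 ≤ A * B →
    (A + 2 * t + B) ^ (n + 1) ≤
      A ^ (n + 1) + 2 * (n + 1) * A ^ n * t + C * B * (A + B) ^ n := by
  induction n with
  | zero => exact ⟨1, zero_le_one, fun A B t _ _ _ => by simp⟩
  | succ n ih =>
    obtain ⟨C, hC, ih⟩ := ih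
    -- The three parts pay for the old remainder (as `A + 2t + B ≤ 2(A + B)`), for `A^(n+1) B`, and
    -- for the cross terms `4 A^n t²` and `2 A^n t B`.
    refine ⟨2 * C + 1 + 6 * (n + 1), by positivity, fun A B t hA hB ht => ?_⟩
    have habs : |2 * t| ≤ A + B := abs_le_of_sq_le_sq (by nlinarith [sq_nonneg (A - B)])
      (by positivity)
    obtain ⟨h1, h2⟩ := abs_le.1 habs
    have hS : 0 ≤ A + 2 * t + B := by linarith
    have hAn : A ^ n ≤ (A + B) ^ n := pow_le_pow_left₀ hA (by linarith) n
    have hA0 : 0 ≤ A ^ n := pow_nonneg hA n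
    have hAB0 : 0 ≤ (A + B) ^ n := by positivity
    have hn : (0 : ℝ) ≤ n := n.cast_nonneg
    have e1 : A * A ^ n * B ≤ (A + B) * (A + B) ^ n * B := by gcongr; linarith
    have e2 : A ^ n * t ^ 2 ≤ (A + B) * (A + B) ^ n * B := by
      calc A ^ n * t ^ 2 ≤ A ^ n * (A * B) := by gcongr
        _ = A * A ^ n * B := by ring
        _ ≤ _ := e1
    have e3 : A ^ n * t * B ≤ (A + B) * (A + B) ^ n * B := by
      calc A ^ n * t * B ≤ A ^ n * (A + B) * B := by gcongr; linarith
        _ ≤ (A + B) ^ n * (A + B) * B := by gcongr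
        _ = _ := by ring
    have e4 : C * B * (A + B) ^ n * (A + 2 * t + B) ≤
        2 * (C * ((A + B) * (A + B) ^ n * B)) := by
      calc C * B * (A + B) ^ n * (A + 2 * t + B)
          ≤ C * B * (A + B) ^ n * (2 * (A + B)) := by gcongr; linarith
        _ = _ := by ring
    calc (A + 2 * t + B) ^ (n + 1 + 1)
        = (A + 2 * t + B) ^ (n + 1) * (A + 2 * t + B) := pow_succ _ _
      _ ≤ (A ^ (n + 1) + 2 * (n + 1) * A ^ n * t + C * B * (A + B) ^ n) * (A + 2 * t + B) := by
          gcongr; exact ih A B t hA hB ht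
      _ = A ^ (n + 2) + 2 * (n + 2) * A ^ (n + 1) * t + A * A ^ n * B
          + (n + 1) * (4 * (A ^ n * t ^ 2) + 2 * (A ^ n * t * B))
          + C * B * (A + B) ^ n * (A + 2 * t + B) := by ring
      _ ≤ A ^ (n + 2) + 2 * (n + 2) * A ^ (n + 1) * t + (A + B) * (A + B) ^ n * B
          + (n + 1) * (4 * ((A + B) * (A + B) ^ n * B) + 2 * ((A + B) * (A + B) ^ n * B))
          + 2 * (C * ((A + B) * (A + B) ^ n * B)) := by gcongr
      _ = _ := by push_cast; ring

/-- The weight in front of `α * θ` in the one-step moment estimate. -/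
noncomputable def stepWeight (n : ℕ) (θ X : ℝ) : ℝ :=
  (1 + X) * X ^ (2 * n + 1) + (1 + X) ^ 2 * X ^ (2 * n) + (1 + X) ^ (2 * n + 2) * θ ^ (2 * n)

theorem stepWeight_nonneg (n : ℕ) {θ X : ℝ} (hθ : 0 ≤ θ) (hX : 0 ≤ X) :
    0 ≤ stepWeight n θ X := by
  unfold stepWeight; positivity

theorem stepWeight_mono (n : ℕ) {θ X Y : ℝ} (hθ : 0 ≤ θ) (hX : 0 ≤ X) (h : X ≤ Y) :
    stepWeight n θ X ≤ stepWeight n θ Y := by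
  have : 0 ≤ Y := hX.trans h
  unfold stepWeight; gcongr

/-- For `X ≥ 1` the weight is of order `X^(2n+2)`, and a small `θ` makes it absorbable. For `X ≤ 1`
the main term is `θ X^(2n)`: either `θ` is at most of order `X²`, and it is absorbed, or `X²` is at
most of order `θ`, and it is of order `θ^(n+1)`. This gain in the power of `θ` is the reason for
using high moments. -/
theorem exists_mul_stepWeight_le (n : ℕ) {C c : ℝ} (hC : 0 ≤ C) (hc : 0 < c) :
    ∃ θ₀ C' : ℝ, 0 < θ₀ ∧ 0 ≤ C' ∧ ∀ θ X : ℝ, 0 ≤ θ → θ ≤ θ₀ → 0 ≤ X →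
      C * θ * stepWeight n θ X ≤ c * X ^ (2 * n + 2) + C' * θ ^ (n + 1) := by
  have hq : (0 : ℝ) < 6 + 4 ^ (n + 1) := by positivity
  refine ⟨min 1 (c / ((C + 1) * (6 + 4 ^ (n + 1)))),
    C * 4 ^ (n + 1) + 6 * C * (6 * C / c) ^ n, by positivity, by positivity,
    fun θ X hθ hle hX => ?_⟩
  have hθ1 : θ ≤ 1 := hle.trans (min_le_left _ _)
  have hθc : θ * ((C + 1) * (6 + 4 ^ (n + 1))) ≤ c :=
    (le_div_iff₀ (by positivity)).1 (hle.trans (min_le_right _ _))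
  have hθ2 : θ ^ (2 * n) ≤ 1 := pow_le_one₀ hθ hθ1
  have hfour : (2 : ℝ) ^ (2 * n + 2) = 4 ^ (n + 1) := by
    rw [show 2 * n + 2 = 2 * (n + 1) by ring, pow_mul]; norm_num
  rcases le_total 1 X with h1 | h1
  · have hw : stepWeight n θ X ≤ (6 + 4 ^ (n + 1)) * X ^ (2 * n + 2) := by
      unfold stepWeight
      calc _ ≤ (X + X) * X ^ (2 * n + 1) + (X + X) ^ 2 * X ^ (2 * n)
            + (X + X) ^ (2 * n + 2) * 1 := by gcongr
        _ = (6 + 2 ^ (2 * n + 2)) * X ^ (2 * n + 2) := by ring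
        _ = _ := by rw [hfour]
    calc C * θ * stepWeight n θ X ≤ C * θ * ((6 + 4 ^ (n + 1)) * X ^ (2 * n + 2)) := by gcongr
      _ = (θ * (C * (6 + 4 ^ (n + 1)))) * X ^ (2 * n + 2) := by ring
      _ ≤ (θ * ((C + 1) * (6 + 4 ^ (n + 1)))) * X ^ (2 * n + 2) := by gcongr; linarith
      _ ≤ c * X ^ (2 * n + 2) := by gcongr
      _ ≤ _ := le_add_of_nonneg_right (by positivity)
  · have hw : stepWeight n θ X ≤ 6 * X ^ (2 * n) + 4 ^ (n + 1) * θ ^ (2 * n) := by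
      unfold stepWeight
      calc _ ≤ (1 + 1) * (X ^ (2 * n) * 1) + (1 + 1) ^ 2 * X ^ (2 * n)
            + (1 + 1) ^ (2 * n + 2) * θ ^ (2 * n) := by rw [pow_succ X]; gcongr
        _ = 6 * X ^ (2 * n) + 2 ^ (2 * n + 2) * θ ^ (2 * n) := by ring
        _ = _ := by rw [hfour]
    have hθn : θ * θ ^ (2 * n) ≤ θ ^ (n + 1) := by
      calc θ * θ ^ (2 * n) = θ ^ (2 * n + 1) := by ring
        _ ≤ θ ^ (n + 1) := pow_le_pow_of_le_one hθ hθ1 (by omega)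
    have key : 6 * C * θ * X ^ (2 * n) ≤
        c * X ^ (2 * n + 2) + 6 * C * (6 * C / c) ^ n * θ ^ (n + 1) := by
      rcases le_total (6 * C * θ) (c * X ^ 2) with h | h
      · calc 6 * C * θ * X ^ (2 * n) ≤ c * X ^ 2 * X ^ (2 * n) := by gcongr
          _ = c * X ^ (2 * n + 2) := by ring
          _ ≤ _ := le_add_of_nonneg_right (by positivity)
      · have hX2 : X ^ 2 ≤ 6 * C / c * θ := by
          rw [div_mul_eq_mul_div, le_div_iff₀ hc]; linarith
        calc 6 * C * θ * X ^ (2 * n) = 6 * C * θ * (X ^ 2) ^ n := by rw [pow_mul]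
          _ ≤ 6 * C * θ * (6 * C / c * θ) ^ n := by gcongr
          _ = 6 * C * (6 * C / c) ^ n * θ ^ (n + 1) := by rw [mul_pow]; ring
          _ ≤ _ := le_add_of_nonneg_left (by positivity)
    calc C * θ * stepWeight n θ X
        ≤ C * θ * (6 * X ^ (2 * n) + 4 ^ (n + 1) * θ ^ (2 * n)) := by gcongr
      _ = 6 * C * θ * X ^ (2 * n) + C * 4 ^ (n + 1) * (θ * θ ^ (2 * n)) := by ring
      _ ≤ (c * X ^ (2 * n + 2) + 6 * C * (6 * C / c) ^ n * θ ^ (n + 1))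
          + C * 4 ^ (n + 1) * θ ^ (n + 1) := by gcongr
      _ = _ := by ring

/-! ### One-step estimate under truncation -/

section

variable {E : Type*} [NormedAddCommGroup E] [InnerProductSpace ℝ E]

/-- One-step estimate for a truncated noise `w`: the left-hand side is `0` if the noise is above
the truncation level. -/
theorem exists_norm_pow_step_le (n : ℕ) : ∃ C : ℝ, 0 ≤ C ∧ ∀ (a w : E) (α θ X p : ℝ),
    0 < α → 0 < θ → 0 ≤ X → 1 ≤ p → ‖a‖ ≤ X →
    (∀ r : ℝ, θ / α ≤ r → r ≤ θ * r ^ p) →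
    (if α * ‖w‖ ≤ (1 + X) * θ then ‖a + α • w‖ ^ (2 * n + 2) else 0) ≤
      ‖a‖ ^ (2 * n + 2) + 2 * (n + 1) * α * (‖a‖ ^ (2 * n) * inner ℝ a w) +
        C * α * θ * stepWeight n θ X * (1 + (‖w‖ / (1 + X)) ^ p) := by
  obtain ⟨C, hC, hpow⟩ := exists_add_pow_succ_le n
  refine ⟨C * 2 ^ n + 2 * (n + 1), by positivity, fun a w α θ X p hα hθ hX hp haX hthr => ?_⟩
  have hD : 0 < 1 + X := by positivity
  set D := 1 + X with hDdef
  set R := (‖w‖ / D) ^ p with hR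
  have hR0 : 0 ≤ R := by positivity
  have hn : (0 : ℝ) ≤ n := n.cast_nonneg
  have hwt := stepWeight_nonneg n hθ.le hX
  split_ifs with h
  · have hwD : ‖w‖ ≤ D * (1 + R) := by
      have : ‖w‖ / D ≤ 1 + R := by
        rcases le_total (‖w‖ / D) 1 with h1 | h1
        · linarith
        · have := Real.self_le_rpow_of_one_le h1 hp
          linarith
      rw [div_le_iff₀ hD] at this
      linarith
    have ht : (α * inner ℝ a w) ^ 2 ≤ ‖a‖ ^ 2 * (α * ‖w‖) ^ 2 := by
      have h1 := real_inner_mul_inner_self_le a w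
      have h2 : (inner ℝ a w) ^ 2 ≤ ‖a‖ ^ 2 * ‖w‖ ^ 2 := by
        rw [real_inner_self_eq_norm_sq, real_inner_self_eq_norm_sq] at h1
        nlinarith
      calc (α * inner ℝ a w) ^ 2 = α ^ 2 * (inner ℝ a w) ^ 2 := by ring
        _ ≤ α ^ 2 * (‖a‖ ^ 2 * ‖w‖ ^ 2) := by gcongr
        _ = _ := by ring
    have hexp : ‖a + α • w‖ ^ 2 = ‖a‖ ^ 2 + 2 * (α * inner ℝ a w) + (α * ‖w‖) ^ 2 := by
      rw [norm_add_sq_real, inner_smul_right, norm_smul, Real.norm_of_nonneg hα.le]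
    have main := hpow (‖a‖ ^ 2) ((α * ‖w‖) ^ 2) (α * inner ℝ a w) (by positivity) (by positivity) ht
    rw [← hexp] at main
    -- One factor `α‖w‖` is bounded through `R`, the other by the truncation level; the product has
    -- the needed size `α θ`.
    have hB : (α * ‖w‖) ^ 2 ≤ α * θ * (D ^ 2 * (1 + R)) := by
      calc (α * ‖w‖) ^ 2 = (α * ‖w‖) * (α * ‖w‖) := by ring
        _ ≤ (α * (D * (1 + R))) * (D * θ) := by gcongr
        _ = _ := by ring
    have hsum : (‖a‖ ^ 2 + (α * ‖w‖) ^ 2) ^ n ≤ 2 ^ n * (X ^ (2 * n) + (D * θ) ^ (2 * n)) := by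
      calc (‖a‖ ^ 2 + (α * ‖w‖) ^ 2) ^ n ≤ (X ^ 2 + (D * θ) ^ 2) ^ n := by gcongr
        _ ≤ 2 ^ n * ((X ^ 2) ^ n + ((D * θ) ^ 2) ^ n) := by
            refine (add_pow_le (by positivity) (by positivity) n).trans ?_
            gcongr
            · norm_num
            · omega
        _ = _ := by rw [← pow_mul, ← pow_mul]
    have hQ : D ^ 2 * (X ^ (2 * n) + (D * θ) ^ (2 * n)) ≤ stepWeight n θ X := by
      unfold stepWeight
      rw [mul_pow, ← hDdef]
      have : 0 ≤ D * X ^ (2 * n + 1) := by positivity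
      calc _ = 0 + D ^ 2 * X ^ (2 * n) + D ^ (2 * n + 2) * θ ^ (2 * n) := by ring
        _ ≤ _ := by gcongr
    calc ‖a + α • w‖ ^ (2 * n + 2) = (‖a + α • w‖ ^ 2) ^ (n + 1) := by rw [← pow_mul]; ring_nf
      _ ≤ _ := main
      _ ≤ (‖a‖ ^ 2) ^ (n + 1) + 2 * (n + 1) * (‖a‖ ^ 2) ^ n * (α * inner ℝ a w)
          + C * (α * θ * (D ^ 2 * (1 + R))) * (2 ^ n * (X ^ (2 * n) + (D * θ) ^ (2 * n))) := by
          gcongr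
      _ = ‖a‖ ^ (2 * n + 2) + 2 * (n + 1) * α * (‖a‖ ^ (2 * n) * inner ℝ a w)
          + C * 2 ^ n * α * θ * (D ^ 2 * (X ^ (2 * n) + (D * θ) ^ (2 * n))) * (1 + R) := by
          rw [← pow_mul, ← pow_mul]; ring
      _ ≤ _ := by
          gcongr
          linarith
  -- Above the level the left side is `0`, so only a very negative linear term could do harm. The
  -- threshold hypothesis turns `‖w‖` into at most `D θ R`, which the last term covers.
  · push Not at h
    have hr : θ / α ≤ ‖w‖ / D := by
      rw [div_le_div_iff₀ hα hD]; linarith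
    have hw : ‖w‖ ≤ D * θ * R := by
      have := hthr _ hr
      rw [div_le_iff₀ hD] at this
      linarith
    have hin : -(‖a‖ * ‖w‖) ≤ inner ℝ a w := (abs_le.1 (abs_real_inner_le_norm a w)).1
    have hQ : D * X ^ (2 * n + 1) ≤ stepWeight n θ X := by
      unfold stepWeight
      rw [← hDdef, add_assoc]
      exact le_add_of_nonneg_right (by positivity)
    have h1 : ‖a‖ ^ (2 * n) * (‖a‖ * ‖w‖) ≤ θ * stepWeight n θ X * (1 + R) := by
      calc ‖a‖ ^ (2 * n) * (‖a‖ * ‖w‖) ≤ X ^ (2 * n) * (X * (D * θ * R)) := by gcongr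
        _ = θ * (D * X ^ (2 * n + 1)) * R := by ring
        _ ≤ θ * stepWeight n θ X * (1 + R) := by gcongr; linarith
    have h2 : -(θ * stepWeight n θ X * (1 + R)) ≤ ‖a‖ ^ (2 * n) * inner ℝ a w := by
      have : ‖a‖ ^ (2 * n) * -(‖a‖ * ‖w‖) ≤ ‖a‖ ^ (2 * n) * inner ℝ a w := by gcongr
      linarith
    have h3 : 2 * (n + 1) * α * -(θ * stepWeight n θ X * (1 + R)) ≤
        2 * (n + 1) * α * (‖a‖ ^ (2 * n) * inner ℝ a w) := by gcongr
    have h4 : 0 ≤ C * 2 ^ n * (α * θ * stepWeight n θ X * (1 + R)) := by positivity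
    have h5 : 0 ≤ ‖a‖ ^ (2 * n + 2) := by positivity
    nlinarith
end

/-! ### Noisy contractions and the truncated moment recursion -/

section

/-- The measures with densities `f` and `h`, restricted to the sub-σ-algebra, are ordered;
integrating `g` against both gives the claim with no integrability needed. -/
theorem lintegral_mul_le_of_setLIntegral_le {Ω : Type*} {m m0 : MeasurableSpace Ω}
    {μ : Measure Ω} (hm : m ≤ m0)
    {f h g : Ω → ℝ≥0∞} (hf : Measurable f) (hh : Measurable h) (hg : Measurable[m] g)
    (H : ∀ S, MeasurableSet[m] S → ∫⁻ ω in S, f ω ∂μ ≤ ∫⁻ ω in S, h ω ∂μ) :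
    ∫⁻ ω, g ω * f ω ∂μ ≤ ∫⁻ ω, g ω * h ω ∂μ := by
  have key : (μ.withDensity f).trim hm ≤ (μ.withDensity h).trim hm := by
    refine Measure.le_iff.2 fun S hS => ?_
    rw [trim_measurableSet_eq hm hS, trim_measurableSet_eq hm hS, withDensity_apply _ (hm S hS),
      withDensity_apply _ (hm S hS)]
    exact H S hS
  have e : ∀ φ : Ω → ℝ≥0∞, Measurable φ →
      ∫⁻ ω, g ω * φ ω ∂μ = ∫⁻ ω, g ω ∂(μ.withDensity φ).trim hm := fun φ hφ => by
    rw [lintegral_trim hm hg, lintegral_withDensity_eq_lintegral_mul _ hφ (hg.mono hm le_rfl)]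
    exact lintegral_congr fun ω => mul_comm _ _
  rw [e f hf, e h hh]
  exact lintegral_mono' key le_rfl

variable {Ω : Type*} {m0 : MeasurableSpace Ω} {μ : Measure Ω}
variable {E : Type*} [NormedAddCommGroup E] [InnerProductSpace ℝ E]

/-- A process `x (k + 1) = a k + α k • w k` whose deterministic part `a k` contracts towards `0`,
driven by unbiased noise `w` with a `p`-th moment growth condition. -/
structure NoisyContraction (μ : Measure Ω) (ℱ : Filtration ℕ m0) (c p C : ℝ) (α : ℕ → ℝ)
    (x a w : ℕ → Ω → E) : Prop where
  measurable_state : ∀ k, StronglyMeasurable[ℱ k] (x k)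
  measurable_drift : ∀ k, StronglyMeasurable[ℱ k] (a k)
  measurable_noise : ∀ k, StronglyMeasurable[ℱ (k + 1)] (w k)
  integrable_noise : ∀ k, Integrable (w k) μ
  unbiased : ∀ k, μ[w k | ℱ k] =ᵐ[μ] 0
  moment : ∀ k S, MeasurableSet[ℱ k] S →
    ∫⁻ ω in S, ENNReal.ofReal (‖w k ω‖ ^ p) ∂μ ≤
      ∫⁻ ω in S, ENNReal.ofReal (C * (1 + ‖x k ω‖) ^ p) ∂μ
  step : ∀ k ω, x (k + 1) ω = a k ω + α k • w k ω
  contract : ∀ k ω, ‖a k ω‖ ≤ (1 - c * α k) * ‖x k ω‖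

namespace NoisyContraction

variable {ℱ : Filtration ℕ m0} {c p C : ℝ} {α : ℕ → ℝ} {x a w : ℕ → Ω → E}

/-- The moment condition is tested against `g / (1 + ‖x k‖)^p`, which is known at time `k`; the
growth in `‖x k‖` cancels. -/
theorem integral_mul_le [IsFiniteMeasure μ] (h : NoisyContraction μ ℱ c p C α x a w) (hC : 0 ≤ C)
    (k : ℕ) {g : Ω → ℝ} (hg : StronglyMeasurable[ℱ k] g) (hg0 : ∀ ω, 0 ≤ g ω) {B : ℝ}
    (hgB : ∀ ω, g ω ≤ B) :
    Integrable (fun ω => g ω * (‖w k ω‖ / (1 + ‖x k ω‖)) ^ p) μ ∧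
      ∫ ω, g ω * (‖w k ω‖ / (1 + ‖x k ω‖)) ^ p ∂μ ≤ C * ∫ ω, g ω ∂μ := by
  have hxm : Measurable[ℱ k] fun ω => ‖x k ω‖ := (h.measurable_state k).norm.measurable
  have hwm : Measurable fun ω => ‖w k ω‖ :=
    ((h.measurable_noise k).norm.mono (ℱ.le _)).measurable
  have hxm' : Measurable fun ω => ‖x k ω‖ := hxm.mono (ℱ.le _) le_rfl
  have hgm' : Measurable g := hg.measurable.mono (ℱ.le _) le_rfl
  have hD : ∀ ω, 0 < (1 + ‖x k ω‖) ^ p := fun ω => by positivity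
  have hgi : Integrable g μ := Integrable.of_bound hgm'.aestronglyMeasurable B
    (.of_forall fun ω => by rw [Real.norm_of_nonneg (hg0 ω)]; exact hgB ω)
  have hmeas : Measurable fun ω => g ω * (‖w k ω‖ / (1 + ‖x k ω‖)) ^ p := by fun_prop
  have hle : ∫⁻ ω, ENNReal.ofReal (g ω * (‖w k ω‖ / (1 + ‖x k ω‖)) ^ p) ∂μ ≤
      ENNReal.ofReal (C * ∫ ω, g ω ∂μ) := by
    calc ∫⁻ ω, ENNReal.ofReal (g ω * (‖w k ω‖ / (1 + ‖x k ω‖)) ^ p) ∂μ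
        = ∫⁻ ω, ENNReal.ofReal (g ω / (1 + ‖x k ω‖) ^ p) * ENNReal.ofReal (‖w k ω‖ ^ p) ∂μ := by
          refine lintegral_congr fun ω => ?_
          rw [← ENNReal.ofReal_mul (div_nonneg (hg0 ω) (hD ω).le),
            Real.div_rpow (norm_nonneg _) (by positivity)]
          congr 1; ring
      _ ≤ ∫⁻ ω, ENNReal.ofReal (g ω / (1 + ‖x k ω‖) ^ p) *
            ENNReal.ofReal (C * (1 + ‖x k ω‖) ^ p) ∂μ := by
          refine lintegral_mul_le_of_setLIntegral_le (ℱ.le k) (by fun_prop) (by fun_prop) ?_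
            (h.moment k)
          have := hg.measurable
          exact (this.div ((hxm.const_add 1).pow_const p)).ennreal_ofReal
      _ = ∫⁻ ω, ENNReal.ofReal (C * g ω) ∂μ := by
          refine lintegral_congr fun ω => ?_
          rw [← ENNReal.ofReal_mul (div_nonneg (hg0 ω) (hD ω).le)]
          congr 1
          have := (hD ω).ne'
          field_simp
      _ = ENNReal.ofReal (C * ∫ ω, g ω ∂μ) := by
          rw [← integral_const_mul, ofReal_integral_eq_lintegral_ofReal (hgi.const_mul C)
            (.of_forall fun ω => mul_nonneg hC (hg0 ω))]
  have hnn : ∀ ω, 0 ≤ g ω * (‖w k ω‖ / (1 + ‖x k ω‖)) ^ p := fun ω =>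
    mul_nonneg (hg0 ω) (by positivity)
  have hint : Integrable (fun ω => g ω * (‖w k ω‖ / (1 + ‖x k ω‖)) ^ p) μ :=
    ⟨hmeas.aestronglyMeasurable, by
      rw [hasFiniteIntegral_iff_ofReal (.of_forall hnn)]
      exact hle.trans_lt ENNReal.ofReal_lt_top⟩
  refine ⟨hint, ?_⟩
  rw [← ofReal_integral_eq_lintegral_ofReal hint (.of_forall hnn)] at hle
  exact (ENNReal.ofReal_le_ofReal_iff (mul_nonneg hC (integral_nonneg hg0))).1 hle

/-- The bounded factor `u` is known at time `k`, so it comes out of the conditional expectation. -/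
theorem integral_inner_eq_zero [CompleteSpace E] [IsFiniteMeasure μ]
    (h : NoisyContraction μ ℱ c p C α x a w)
    (k : ℕ) {u : Ω → E} (hu : StronglyMeasurable[ℱ k] u) {B : ℝ} (huB : ∀ ω, ‖u ω‖ ≤ B) :
    Integrable (fun ω => inner ℝ (u ω) (w k ω)) μ ∧ ∫ ω, inner ℝ (u ω) (w k ω) ∂μ = 0 := by
  have hu' : StronglyMeasurable u := hu.mono (ℱ.le k)
  have hint : Integrable (fun ω => inner ℝ (u ω) (w k ω)) μ := by
    refine Integrable.mono' ((h.integrable_noise k).norm.const_mul B)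
      (hu'.aestronglyMeasurable.inner (h.integrable_noise k).aestronglyMeasurable)
      (.of_forall fun ω => ?_)
    exact (norm_inner_le_norm _ _).trans (by gcongr; exact huB ω)
  refine ⟨hint, ?_⟩
  have := condExp_bilin_of_stronglyMeasurable_left (μ := μ) (innerSL ℝ) hu hint
    (h.integrable_noise k)
  rw [← integral_condExp (ℱ.le k)]
  rw [← integral_zero Ω ℝ (μ := μ)]
  refine integral_congr_ae ?_
  filter_upwards [this, h.unbiased k] with ω h1 h2
  refine h1.trans ?_
  rw [h2]; simp

/-- The event that the noise stays below the truncation level before time `k`, and that the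
process starts in the ball of radius `M`. -/
def goodEvent (α θ : ℕ → ℝ) (M : ℝ) (x w : ℕ → Ω → E) : ℕ → Set Ω
  | 0 => {ω | ‖x 0 ω‖ ≤ M}
  | k + 1 => goodEvent α θ M x w k ∩ {ω | α k * ‖w k ω‖ ≤ (1 + ‖x k ω‖) * θ k}

theorem measurableSet_goodEvent (h : NoisyContraction μ ℱ c p C α x a w) (θ : ℕ → ℝ) (M : ℝ)
    (k : ℕ) : MeasurableSet[ℱ k] (goodEvent α θ M x w k) := by
  induction k with
  | zero =>
    exact measurableSet_le (mδ := ℱ 0) (h.measurable_state 0).norm.measurable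
      measurable_const
  | succ k ih =>
    refine MeasurableSet.inter (ℱ.mono k.le_succ _ ih) ?_
    have h1 : Measurable[ℱ (k + 1)] fun ω => ‖w k ω‖ := (h.measurable_noise k).norm.measurable
    have h2 : Measurable[ℱ (k + 1)] fun ω => ‖x k ω‖ :=
      ((h.measurable_state k).mono (ℱ.mono k.le_succ)).norm.measurable
    exact measurableSet_le (mδ := ℱ (k + 1)) (h1.const_mul _)
      ((h2.const_add 1).mul_const _)

theorem norm_drift_le (h : NoisyContraction μ ℱ c p C α x a w) (hc : 0 ≤ c) (hα : ∀ k, 0 < α k)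
    (k : ℕ) (ω : Ω) : ‖a k ω‖ ≤ ‖x k ω‖ := by
  have h1 := h.contract k ω
  have h2 : 0 ≤ c * α k * ‖x k ω‖ := mul_nonneg (mul_nonneg hc (hα k).le) (norm_nonneg _)
  nlinarith

/-- Below the truncation level a step adds at most `(1 + ‖x k‖) θ k` to the norm, so a deterministic
bound propagates. It makes every power of the stopped process integrable, although only a `p`-th
moment of the noise is controlled. -/
theorem exists_bound_on_goodEvent (h : NoisyContraction μ ℱ c p C α x a w) (hc : 0 ≤ c)
    (hα : ∀ k, 0 < α k) (θ : ℕ → ℝ) (hθ : ∀ k, 0 < θ k) (M : ℝ) (k : ℕ) :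
    ∃ r : ℝ, ∀ ω ∈ goodEvent α θ M x w k, ‖x k ω‖ ≤ r := by
  induction k with
  | zero => exact ⟨M, fun ω hω => hω⟩
  | succ k ih =>
    obtain ⟨r, hr⟩ := ih
    refine ⟨r + (1 + r) * θ k, fun ω hω => ?_⟩
    have h1 := hr ω hω.1
    have h2 : α k * ‖w k ω‖ ≤ (1 + ‖x k ω‖) * θ k := hω.2
    have := (hθ k).le
    rw [h.step]
    calc ‖a k ω + α k • w k ω‖ ≤ ‖a k ω‖ + α k * ‖w k ω‖ := by
          refine (norm_add_le _ _).trans ?_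
          rw [norm_smul, Real.norm_of_nonneg (hα k).le]
      _ ≤ ‖x k ω‖ + (1 + ‖x k ω‖) * θ k := add_le_add (h.norm_drift_le hc hα k ω) h2
      _ ≤ r + (1 + r) * θ k := by gcongr

/-- A power of the norm of the process, stopped to be `0` off the good event. -/
noncomputable def truncPow (n : ℕ) (α θ : ℕ → ℝ) (M : ℝ) (x w : ℕ → Ω → E) (k : ℕ) : Ω → ℝ :=
  (goodEvent α θ M x w k).indicator fun ω => ‖x k ω‖ ^ (2 * n + 2)

theorem truncPow_nonneg {E : Type*} [NormedAddCommGroup E] (n : ℕ) (α θ : ℕ → ℝ) (M : ℝ)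
    (x w : ℕ → Ω → E) (k : ℕ) (ω : Ω) :
    0 ≤ truncPow n α θ M x w k ω :=
  Set.indicator_nonneg (fun _ _ => by positivity) _

theorem stronglyMeasurable_truncPow (h : NoisyContraction μ ℱ c p C α x a w) (n : ℕ) (θ : ℕ → ℝ)
    (M : ℝ) (k : ℕ) : StronglyMeasurable[ℱ k] (truncPow n α θ M x w k) :=
  ((h.measurable_state k).norm.pow _).indicator (h.measurableSet_goodEvent θ M k)

theorem integrable_truncPow [IsFiniteMeasure μ] (h : NoisyContraction μ ℱ c p C α x a w)
    (hc : 0 ≤ c) (hα : ∀ k, 0 < α k) (n : ℕ) (θ : ℕ → ℝ) (hθ : ∀ k, 0 < θ k) (M : ℝ) (k : ℕ) :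
    Integrable (truncPow n α θ M x w k) μ := by
  obtain ⟨r, hr⟩ := h.exists_bound_on_goodEvent hc hα θ hθ M k
  refine Integrable.of_bound
    ((h.stronglyMeasurable_truncPow n θ M k).mono (ℱ.le k)).aestronglyMeasurable
    (|r| ^ (2 * n + 2)) (.of_forall fun ω => ?_)
  rw [Real.norm_of_nonneg (truncPow_nonneg ..)]
  refine Set.indicator_apply_le' (fun hω => ?_) fun _ => by positivity
  gcongr
  exact (hr ω hω).trans (le_abs_self r)

/-- The one-step drift estimate for the truncated power, integrated over an event of the past. -/
theorem exists_setIntegral_truncPow_succ_le [CompleteSpace E] (n : ℕ) {c p C : ℝ} (hc : 0 < c)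
    (hp : 1 ≤ p) (hC : 0 ≤ C) : ∃ θ₀ C' : ℝ, 0 < θ₀ ∧ 0 ≤ C' ∧
    ∀ (Ω : Type*) (m0 : MeasurableSpace Ω) (μ : Measure Ω) [IsProbabilityMeasure μ]
      (ℱ : Filtration ℕ m0) (α θ : ℕ → ℝ) (M : ℝ) (x a w : ℕ → Ω → E),
      NoisyContraction μ ℱ c p C α x a w → (∀ k, 0 < α k) → (∀ k, c * α k ≤ 1) → (∀ k, 0 < θ k) →
      (∀ k, θ k ≤ θ₀) → (∀ k, ∀ r : ℝ, θ k / α k ≤ r → r ≤ θ k * r ^ p) →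
      ∀ k S, MeasurableSet[ℱ k] S →
        ∫ ω in S, truncPow n α θ M x w (k + 1) ω ∂μ ≤
          ∫ ω in S, ((1 - c / 2 * α k) * truncPow n α θ M x w k ω
            + C' * (α k * θ k ^ (n + 1))) ∂μ := by
  classical
  obtain ⟨C₀, hC₀, hstep⟩ := exists_norm_pow_step_le (E := E) n
  -- The factor `1 + C` bounds the conditional mean of `1 + (‖w‖ / (1 + ‖x‖))^p`; half of the
  -- contraction rate is spent on absorbing the weight.
  obtain ⟨θ₀, C', hθ₀, hC', hweight⟩ := exists_mul_stepWeight_le n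
    (C := C₀ * (1 + C)) (by positivity) (half_pos hc)
  refine ⟨θ₀, C', hθ₀, hC', fun Ω m0 μ _ ℱ α θ M x a w h hα hcα hθ hθle hthr k S hS => ?_⟩
  obtain ⟨r, hr⟩ := h.exists_bound_on_goodEvent hc.le hα θ hθ M k
  set G := goodEvent α θ M x w k with hG
  have hGm : MeasurableSet[ℱ k] G := h.measurableSet_goodEvent θ M k
  have hTm : MeasurableSet[ℱ k] (S ∩ G) := hS.inter hGm
  have hS0 : MeasurableSet S := ℱ.le k _ hS
  have hxs := h.measurable_state k
  have has := h.measurable_drift k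
  have hax := h.norm_drift_le hc.le hα k
  -- The remainder weight, the vector paired with the noise and the leading term are all cut off to
  -- `S ∩ G`, an event of time `k` on which they are bounded.
  set g : Ω → ℝ := (S ∩ G).indicator fun ω => stepWeight n (θ k) ‖x k ω‖ with hg
  set u : Ω → E := (S ∩ G).indicator fun ω => ‖a k ω‖ ^ (2 * n) • a k ω with hu
  set V : Ω → ℝ := (S ∩ G).indicator fun ω => ‖a k ω‖ ^ (2 * n + 2) with hV
  have hgs : StronglyMeasurable[ℱ k] g := by
    refine StronglyMeasurable.indicator ?_ hTm
    have : Continuous fun X : ℝ => stepWeight n (θ k) X := by unfold stepWeight; fun_prop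
    exact this.comp_stronglyMeasurable hxs.norm
  have hus : StronglyMeasurable[ℱ k] u := ((has.norm.pow _).smul has).indicator hTm
  have hVs : StronglyMeasurable[ℱ k] V := (has.norm.pow _).indicator hTm
  have hg0 : ∀ ω, 0 ≤ g ω := fun ω =>
    Set.indicator_nonneg (fun _ _ => stepWeight_nonneg n (hθ k).le (norm_nonneg _)) _
  have hV0 : ∀ ω, 0 ≤ V ω := fun ω => Set.indicator_nonneg (fun _ _ => by positivity) _
  have hgB : ∀ ω, g ω ≤ stepWeight n (θ k) |r| := fun ω =>
    Set.indicator_apply_le' (fun hω => stepWeight_mono n (hθ k).le (norm_nonneg _)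
      ((hr ω hω.2).trans (le_abs_self r))) fun _ => stepWeight_nonneg n (hθ k).le (abs_nonneg _)
  have huB : ∀ ω, ‖u ω‖ ≤ |r| ^ (2 * n) * |r| := fun ω => by
    by_cases hω : ω ∈ S ∩ G
    · have : ‖a k ω‖ ≤ |r| := (hax ω).trans ((hr ω hω.2).trans (le_abs_self r))
      rw [hu, Set.indicator_of_mem hω, norm_smul, norm_pow, norm_norm]
      gcongr
    · rw [hu, Set.indicator_of_notMem hω, norm_zero]; positivity
  have hVB : ∀ ω, ‖V ω‖ ≤ |r| ^ (2 * n + 2) := fun ω => by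
    rw [Real.norm_of_nonneg (hV0 ω)]
    refine Set.indicator_apply_le' (fun hω => ?_) fun _ => by positivity
    gcongr
    exact (hax ω).trans ((hr ω hω.2).trans (le_abs_self r))
  obtain ⟨hgRi, hgR⟩ := h.integral_mul_le hC k hgs hg0 hgB
  obtain ⟨hwi, hw0⟩ := h.integral_inner_eq_zero k hus huB
  have hgi : Integrable g μ := Integrable.of_bound (hgs.mono (ℱ.le k)).aestronglyMeasurable _
    (.of_forall fun ω => by rw [Real.norm_of_nonneg (hg0 ω)]; exact hgB ω)
  have hVi : Integrable V μ := Integrable.of_bound (hVs.mono (ℱ.le k)).aestronglyMeasurable _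
    (.of_forall hVB)
  have hZi := h.integrable_truncPow hc.le hα n θ hθ M
  have hpt : ∀ ω, S.indicator (truncPow n α θ M x w (k + 1)) ω ≤
      V ω + 2 * (n + 1) * α k * inner ℝ (u ω) (w k ω) +
        (C₀ * α k * θ k * g ω + C₀ * α k * θ k * (g ω * (‖w k ω‖ / (1 + ‖x k ω‖)) ^ p)) := by
    intro ω
    by_cases hω : ω ∈ S ∩ G
    · have := hstep (a k ω) (w k ω) (α k) (θ k) ‖x k ω‖ p (hα k) (hθ k) (norm_nonneg _) hp (hax ω)
        (hthr k)
      rw [Set.indicator_of_mem hω.1, hV, hu, hg, Set.indicator_of_mem hω, Set.indicator_of_mem hω,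
        Set.indicator_of_mem hω]
      calc truncPow n α θ M x w (k + 1) ω
          = if α k * ‖w k ω‖ ≤ (1 + ‖x k ω‖) * θ k then ‖a k ω + α k • w k ω‖ ^ (2 * n + 2)
            else 0 := by
            unfold truncPow
            rw [Set.indicator_apply, h.step k ω]
            refine if_congr ?_ rfl rfl
            exact ⟨fun hh => hh.2, fun hh => ⟨hω.2, hh⟩⟩
        _ ≤ _ := this
        _ = _ := by rw [real_inner_smul_left]; ring
    · rw [hV, hu, hg, Set.indicator_of_notMem hω, Set.indicator_of_notMem hω,
        Set.indicator_of_notMem hω]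
      simp only [inner_zero_left, mul_zero, zero_mul, add_zero]
      refine Set.indicator_apply_le' (fun hωS => ?_) fun _ => le_rfl
      unfold truncPow
      rw [Set.indicator_of_notMem]
      exact fun hh => hω ⟨hωS, hh.1⟩
  -- The leading term shrinks by `1 - c α k`, and the weight returns at most `c/2 * α k` of it.
  have hpt2 : ∀ ω, V ω + C₀ * (1 + C) * α k * θ k * g ω ≤
      S.indicator (fun ω => (1 - c / 2 * α k) * truncPow n α θ M x w k ω
        + C' * (α k * θ k ^ (n + 1))) ω := by
    intro ω
    have hnn : 0 ≤ C' * (α k * θ k ^ (n + 1)) := by have := hα k; have := hθ k; positivity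
    by_cases hω : ω ∈ S ∩ G
    · rw [Set.indicator_of_mem hω.1, hV, hg, Set.indicator_of_mem hω, Set.indicator_of_mem hω]
      unfold truncPow
      rw [Set.indicator_of_mem (hG ▸ hω.2)]
      have h1 := hweight (θ k) ‖x k ω‖ (hθ k).le (hθle k) (norm_nonneg _)
      have h2 : ‖a k ω‖ ^ (2 * n + 2) ≤ (1 - c * α k) * ‖x k ω‖ ^ (2 * n + 2) := by
        have hq : 0 ≤ 1 - c * α k := sub_nonneg.2 (hcα k)
        calc ‖a k ω‖ ^ (2 * n + 2) ≤ ((1 - c * α k) * ‖x k ω‖) ^ (2 * n + 2) := by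
              gcongr; exact h.contract k ω
          _ = (1 - c * α k) ^ (2 * n + 2) * ‖x k ω‖ ^ (2 * n + 2) := mul_pow _ _ _
          _ ≤ (1 - c * α k) * ‖x k ω‖ ^ (2 * n + 2) := by
              gcongr
              exact pow_le_of_le_one hq (by have := mul_pos hc (hα k); linarith) (by omega)
      have h3 := mul_le_mul_of_nonneg_left h1 (hα k).le
      nlinarith
    · rw [hV, hg, Set.indicator_of_notMem hω, Set.indicator_of_notMem hω]
      simp only [mul_zero, add_zero]
      refine Set.indicator_nonneg (fun ω' _ => ?_) _
      have hq : 0 ≤ 1 - c / 2 * α k := by have := hcα k; have := mul_pos hc (hα k); linarith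
      exact add_nonneg (mul_nonneg hq (truncPow_nonneg ..)) hnn
  rw [← integral_indicator hS0, ← integral_indicator hS0]
  have hB : Integrable (fun ω => V ω + 2 * (n + 1) * α k * inner ℝ (u ω) (w k ω)) μ :=
    hVi.add (hwi.const_mul _)
  have hD : Integrable (fun ω => C₀ * α k * θ k * g ω +
      C₀ * α k * θ k * (g ω * (‖w k ω‖ / (1 + ‖x k ω‖)) ^ p)) μ :=
    (hgi.const_mul _).add (hgRi.const_mul _)
  calc ∫ ω, S.indicator (truncPow n α θ M x w (k + 1)) ω ∂μ
      ≤ ∫ ω, (V ω + 2 * (n + 1) * α k * inner ℝ (u ω) (w k ω) +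
        (C₀ * α k * θ k * g ω + C₀ * α k * θ k * (g ω * (‖w k ω‖ / (1 + ‖x k ω‖)) ^ p))) ∂μ :=
        integral_mono ((hZi _).indicator hS0) (hB.add hD) hpt
    _ = ∫ ω, V ω ∂μ + (C₀ * α k * θ k * ∫ ω, g ω ∂μ +
        C₀ * α k * θ k * ∫ ω, g ω * (‖w k ω‖ / (1 + ‖x k ω‖)) ^ p ∂μ) := by
        rw [integral_add hB hD, integral_add hVi (hwi.const_mul _), integral_const_mul, hw0,
          integral_add (hgi.const_mul _) (hgRi.const_mul _), integral_const_mul,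
          integral_const_mul, mul_zero, add_zero]
    _ ≤ ∫ ω, V ω ∂μ + (C₀ * α k * θ k * ∫ ω, g ω ∂μ +
        C₀ * α k * θ k * (C * ∫ ω, g ω ∂μ)) := by
        have := (hα k).le; have := (hθ k).le
        gcongr
    _ = ∫ ω, (V ω + C₀ * (1 + C) * α k * θ k * g ω) ∂μ := by
        rw [integral_add hVi (hgi.const_mul _), integral_const_mul]; ring
    _ ≤ _ := by
        refine integral_mono (hVi.add (hgi.const_mul _)) ?_ hpt2
        exact (((hZi k).const_mul _).add (integrable_const _)).indicator hS0

end NoisyContraction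
end

/-! ### A Robbins–Siegmund argument -/

/-- Adding the tail `∑_{j ≥ k} s j` gives a nonnegative supermartingale, so `Z` converges almost
surely. Telescoping the means shows that `∑ β k * E[Z k]` is finite; as `∑ β k` diverges, `E[Z k]`
comes arbitrarily close to `0` infinitely often, and Fatou forces the limit to vanish. -/
theorem ae_tendsto_zero_of_setIntegral_succ_le {Ω : Type*} {m0 : MeasurableSpace Ω}
    {μ : Measure Ω} [IsProbabilityMeasure μ] {ℱ : Filtration ℕ m0} {Z : ℕ → Ω → ℝ} {β s : ℕ → ℝ}
    (hZm : ∀ k, StronglyMeasurable[ℱ k] (Z k)) (hZi : ∀ k, Integrable (Z k) μ)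
    (hZ0 : ∀ k ω, 0 ≤ Z k ω) (hβ0 : ∀ k, 0 ≤ β k) (hβ : ¬ Summable β) (hs0 : ∀ k, 0 ≤ s k)
    (hs : Summable s)
    (hle : ∀ k S, MeasurableSet[ℱ k] S →
      ∫ ω in S, Z (k + 1) ω ∂μ ≤ ∫ ω in S, ((1 - β k) * Z k ω + s k) ∂μ) :
    ∀ᵐ ω ∂μ, Tendsto (fun k => Z k ω) atTop (𝓝 0) := by
  set T : ℕ → ℝ := fun k => ∑' j, s (j + k) with hT
  have hT0 : ∀ k, 0 ≤ T k := fun k => tsum_nonneg fun j => hs0 _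
  have hTlim : Tendsto T atTop (𝓝 0) := tendsto_sum_nat_add s
  have hTs : ∀ k, T k = s k + T (k + 1) := fun k => by
    have := ((summable_nat_add_iff k).2 hs).tsum_eq_zero_add
    simp only [hT]
    rw [this, zero_add]
    congr 1
    exact tsum_congr fun j => by congr 1; ring
  set Y : ℕ → Ω → ℝ := fun k ω => Z k ω + T k with hY
  have hYi : ∀ k, Integrable (Y k) μ := fun k => (hZi k).add (integrable_const _)
  have hY0 : ∀ k ω, 0 ≤ Y k ω := fun k ω => add_nonneg (hZ0 k ω) (hT0 k)
  have hsuper : Supermartingale Y ℱ μ := by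
    refine supermartingale_of_setIntegral_succ_le
      (fun k => (hZm k).add stronglyMeasurable_const) hYi fun k S hS => ?_
    have hi : Integrable (fun ω => (1 - β k) * Z k ω + s k) μ :=
      ((hZi k).const_mul _).add (integrable_const _)
    calc ∫ ω in S, Y (k + 1) ω ∂μ
        = ∫ ω in S, Z (k + 1) ω ∂μ + ∫ ω in S, T (k + 1) ∂μ :=
          integral_add (hZi _).integrableOn (integrable_const _)
      _ ≤ ∫ ω in S, ((1 - β k) * Z k ω + s k) ∂μ + ∫ ω in S, T (k + 1) ∂μ := by
          exact add_le_add (hle k S hS) le_rfl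
      _ = ∫ ω in S, ((1 - β k) * Z k ω + s k + T (k + 1)) ∂μ :=
          (integral_add hi.integrableOn (integrable_const _)).symm
      _ ≤ ∫ ω in S, Y k ω ∂μ := by
          refine integral_mono (hi.add (integrable_const _)).integrableOn (hYi k).integrableOn
            fun ω => ?_
          have := mul_nonneg (hβ0 k) (hZ0 k ω)
          simp only [hY, hTs k]
          linarith
  have hbdd : ∀ k, eLpNorm ((-Y) k) 1 μ ≤ (∫ ω, Y 0 ω ∂μ).toNNReal := fun k => by
    rw [Pi.neg_apply, eLpNorm_neg, eLpNorm_one_eq_lintegral_enorm]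
    calc ∫⁻ ω, ‖Y k ω‖ₑ ∂μ = ∫⁻ ω, ENNReal.ofReal (Y k ω) ∂μ :=
          lintegral_congr fun ω => Real.enorm_of_nonneg (hY0 k ω)
      _ = ENNReal.ofReal (∫ ω, Y k ω ∂μ) :=
          (ofReal_integral_eq_lintegral_ofReal (hYi k) (.of_forall (hY0 k))).symm
      _ ≤ ENNReal.ofReal (∫ ω, Y 0 ω ∂μ) := by
          refine ENNReal.ofReal_le_ofReal ?_
          simpa using hsuper.setIntegral_le k.zero_le MeasurableSet.univ
  obtain ⟨ℓ, hℓs, hconv⟩ : ∃ ℓ : Ω → ℝ, StronglyMeasurable ℓ ∧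
      ∀ᵐ ω ∂μ, Tendsto (fun k => (-Y) k ω) atTop (𝓝 (ℓ ω)) :=
    ⟨_, Filtration.stronglyMeasurable_limit_process', hsuper.neg.ae_tendsto_limitProcess hbdd⟩
  have hZlim : ∀ᵐ ω ∂μ, Tendsto (fun k => Z k ω) atTop (𝓝 (-ℓ ω)) := by
    filter_upwards [hconv] with ω hω
    have := hω.neg.sub hTlim
    simpa [hY] using this
  set e : ℕ → ℝ := fun k => ∫ ω, Z k ω ∂μ with he
  have he0 : ∀ k, 0 ≤ e k := fun k => integral_nonneg (hZ0 k)
  have hestep : ∀ k, β k * e k ≤ e k - e (k + 1) + s k := fun k => by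
    have := hle k Set.univ MeasurableSet.univ
    simp only [Measure.restrict_univ] at this
    rw [integral_add ((hZi k).const_mul _) (integrable_const _), integral_const_mul] at this
    simp only [integral_const, probReal_univ, one_smul] at this
    simp only [he]
    linarith
  have hsum : Summable fun k => β k * e k := by
    refine summable_of_sum_range_le (c := e 0 + ∑' k, s k)
      (fun k => mul_nonneg (hβ0 k) (he0 k)) fun N => ?_
    calc ∑ k ∈ Finset.range N, β k * e k
        ≤ ∑ k ∈ Finset.range N, (e k - e (k + 1) + s k) := Finset.sum_le_sum fun k _ => hestep k
      _ = e 0 - e N + ∑ k ∈ Finset.range N, s k := by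
          rw [Finset.sum_add_distrib, Finset.sum_range_sub']
      _ ≤ e 0 + ∑' k, s k := by
          have := hs.sum_le_tsum (Finset.range N) fun k _ => hs0 k
          linarith [he0 N]
  -- Otherwise `β k ≤ β k * e k / ε` eventually, and `β` would be summable.
  have hfreq : ∀ ε : ℝ, 0 < ε → ∃ᶠ k in atTop, e k ≤ ε := fun ε hε => by
    intro hcon
    refine hβ ?_
    refine Summable.of_norm_bounded_eventually_nat (hsum.div_const ε) ?_
    filter_upwards [hcon] with k hk
    rw [Real.norm_of_nonneg (hβ0 k), le_div_iff₀ hε]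
    exact mul_le_mul_of_nonneg_left (not_le.1 hk).le (hβ0 k)
  have hfatou : ∫⁻ ω, ENNReal.ofReal (-ℓ ω) ∂μ ≤ 0 := by
    calc ∫⁻ ω, ENNReal.ofReal (-ℓ ω) ∂μ
        = ∫⁻ ω, liminf (fun k => ENNReal.ofReal (Z k ω)) atTop ∂μ := by
          refine lintegral_congr_ae ?_
          filter_upwards [hZlim] with ω hω
          exact ((ENNReal.tendsto_ofReal hω).liminf_eq).symm
      _ ≤ liminf (fun k => ∫⁻ ω, ENNReal.ofReal (Z k ω) ∂μ) atTop :=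
          lintegral_liminf_le fun k => ((hZm k).measurable.mono (ℱ.le k) le_rfl).ennreal_ofReal
      _ = liminf (fun k => ENNReal.ofReal (e k)) atTop := by
          congr 1
          ext k
          exact (ofReal_integral_eq_lintegral_ofReal (hZi k) (.of_forall (hZ0 k))).symm
      _ ≤ 0 := by
          refine le_of_forall_pos_le_add fun ε hε => ?_
          rw [zero_add]
          rcases eq_or_ne ε ∞ with rfl | hε'
          · exact le_top
          refine liminf_le_of_frequently_le' ?_
          refine (hfreq ε.toReal (ENNReal.toReal_pos hε.ne' hε')).mono fun k hk => ?_
          exact (ENNReal.ofReal_le_iff_le_toReal hε').2 hk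
  have hℓm : AEMeasurable (fun ω => ENNReal.ofReal (-ℓ ω)) μ :=
    hℓs.measurable.neg.ennreal_ofReal.aemeasurable
  have hzero := (lintegral_eq_zero_iff' hℓm).1 (le_antisymm hfatou zero_le)
  filter_upwards [hZlim, hzero] with ω h1 h2
  have h3 : -ℓ ω ≤ 0 := ENNReal.ofReal_eq_zero.1 h2
  have h4 : 0 ≤ -ℓ ω := ge_of_tendsto' h1 fun k => hZ0 k ω
  rwa [le_antisymm h3 h4] at h1

/-- The filtration started at time `n`. -/
def MeasureTheory.Filtration.shift {Ω : Type*} {m0 : MeasurableSpace Ω} (ℱ : Filtration ℕ m0)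
    (n : ℕ) : Filtration ℕ m0 where
  seq k := ℱ (n + k)
  mono' _ _ h := ℱ.mono (by omega)
  le' _ := ℱ.le _

/-! ### Removing the truncation -/

namespace NoisyContraction

variable {Ω : Type*} {m0 : MeasurableSpace Ω} {μ : Measure Ω} [IsProbabilityMeasure μ]
  {E : Type*} [NormedAddCommGroup E] [InnerProductSpace ℝ E]
  {ℱ : Filtration ℕ m0} {c p C : ℝ} {α : ℕ → ℝ} {x a w : ℕ → Ω → E}

/-- Smallness of `α` and `θ` holds only eventually, and the noise obeys the level only from a random
time on; both are handled by restarting. -/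
theorem shift {μ : Measure Ω} (h : NoisyContraction μ ℱ c p C α x a w) (n : ℕ) :
    NoisyContraction μ (ℱ.shift n) c p C (fun k => α (n + k)) (fun k => x (n + k))
      (fun k => a (n + k)) (fun k => w (n + k)) where
  measurable_state k := h.measurable_state (n + k)
  measurable_drift k := h.measurable_drift (n + k)
  measurable_noise k := h.measurable_noise (n + k)
  integrable_noise k := h.integrable_noise (n + k)
  unbiased k := h.unbiased (n + k)
  moment k := h.moment (n + k)
  step k := h.step (n + k)
  contract k := h.contract (n + k)

theorem measure_large_noise_le (h : NoisyContraction μ ℱ c p C α x a w) (hp : 0 < p) (hC : 0 ≤ C)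
    (k : ℕ) {r : ℝ} (hr : 0 < r) :
    μ {ω | r * (1 + ‖x k ω‖) < ‖w k ω‖} ≤ ENNReal.ofReal (C / r ^ p) := by
  obtain ⟨hi, hle⟩ := h.integral_mul_le hC k (g := fun _ => 1) stronglyMeasurable_const
    (fun _ => zero_le_one) (B := 1) (fun _ => le_rfl)
  simp only [one_mul] at hi hle
  simp only [integral_const, probReal_univ, one_smul, mul_one] at hle
  have hmk := mul_meas_ge_le_integral_of_nonneg
    (.of_forall fun ω => by positivity) hi (r ^ p)
  have hrp : 0 < r ^ p := by positivity
  rw [← ofReal_measureReal]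
  refine ENNReal.ofReal_le_ofReal ?_
  rw [le_div_iff₀ hrp, mul_comm]
  refine le_trans (mul_le_mul_of_nonneg_left (measureReal_mono fun ω hω => ?_) hrp.le)
    (hmk.trans hle)
  have hω' : r * (1 + ‖x k ω‖) < ‖w k ω‖ := hω
  have : r ≤ ‖w k ω‖ / (1 + ‖x k ω‖) := by
    rw [le_div_iff₀ (by positivity)]; exact hω'.le
  show r ^ p ≤ (‖w k ω‖ / (1 + ‖x k ω‖)) ^ p
  exact Real.rpow_le_rpow hr.le this hp.le

/-- Markov's inequality bounds the probability of exceeding the level at time `k` by `C (α k / θ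
k)^p`; the first Borel–Cantelli lemma applies. -/
theorem ae_eventually_noise_le (h : NoisyContraction μ ℱ c p C α x a w) (hp : 0 < p) (hC : 0 ≤ C)
    {θ : ℕ → ℝ} (hα : ∀ k, 0 < α k) (hθ : ∀ k, 0 < θ k)
    (hsum : Summable fun k => (α k / θ k) ^ p) :
    ∀ᵐ ω ∂μ, ∀ᶠ k in atTop, α k * ‖w k ω‖ ≤ (1 + ‖x k ω‖) * θ k := by
  have hbc : ∑' k, μ {ω | θ k / α k * (1 + ‖x k ω‖) < ‖w k ω‖} ≠ ∞ := by
    refine ne_top_of_le_ne_top (hsum.mul_left C).tsum_ofReal_ne_top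
      (ENNReal.tsum_le_tsum fun k => ?_)
    refine (h.measure_large_noise_le hp hC k (div_pos (hθ k) (hα k))).trans_eq ?_
    rw [← inv_div (θ k) (α k), Real.inv_rpow (div_pos (hθ k) (hα k)).le, div_eq_mul_inv]
  filter_upwards [ae_eventually_notMem hbc] with ω hω
  filter_upwards [hω] with k hk
  have hk' : ‖w k ω‖ ≤ θ k / α k * (1 + ‖x k ω‖) := not_lt.1 hk
  have := mul_le_mul_of_nonneg_left hk' (hα k).le
  have hne := (hα k).ne'
  calc _ ≤ _ := this
    _ = _ := by field_simp

theorem ae_tendsto_zero [CompleteSpace E] (h : NoisyContraction μ ℱ c p C α x a w) (hc : 0 < c)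
    (hp : 1 ≤ p) (hC : 0 ≤ C) {θ : ℕ → ℝ} (n : ℕ) (hα : ∀ k, 0 < α k) (hθ : ∀ k, 0 < θ k)
    (hαlim : Tendsto α atTop (𝓝 0)) (hθlim : Tendsto θ atTop (𝓝 0))
    (hthr : ∀ᶠ k in atTop, ∀ r : ℝ, θ k / α k ≤ r → r ≤ θ k * r ^ p)
    (hαsum : ¬ Summable α) (hαθ : Summable fun k => α k * θ k ^ (n + 1))
    (hsum : Summable fun k => (α k / θ k) ^ p) :
    ∀ᵐ ω ∂μ, Tendsto (fun k => x k ω) atTop (𝓝 0) := by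
  obtain ⟨θ₀, C', hθ₀, hC', hstep⟩ :=
    exists_setIntegral_truncPow_succ_le (E := E) n hc hp hC
  obtain ⟨N₀, hN₀⟩ := eventually_atTop.1 ((hthr.and (hθlim.eventually_le_const hθ₀)).and
    (hαlim.eventually_le_const (inv_pos.2 hc)))
  -- The restart time and the initial radius depend on `ω`. Integers suffice for both, so countably
  -- many null sets are discarded.
  have key : ∀ N M : ℕ, N₀ ≤ N → ∀ᵐ ω ∂μ, Tendsto (fun k => truncPow n (fun k => α (N + k))
      (fun k => θ (N + k)) M (fun k => x (N + k)) (fun k => w (N + k)) k ω) atTop (𝓝 0) := by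
    intro N M hN
    have hs := h.shift N
    have hcα : ∀ k, c * α (N + k) ≤ 1 := fun k => by
      have := mul_le_mul_of_nonneg_left (hN₀ (N + k) (by omega)).2 hc.le
      rwa [mul_inv_cancel₀ hc.ne'] at this
    refine ae_tendsto_zero_of_setIntegral_succ_le (ℱ := ℱ.shift N)
      (β := fun k => c / 2 * α (N + k)) (s := fun k => C' * (α (N + k) * θ (N + k) ^ (n + 1)))
      (hs.stronglyMeasurable_truncPow n _ M)
      (hs.integrable_truncPow hc.le (fun k => hα _) n _ (fun k => hθ _) M)
      (truncPow_nonneg n _ _ _ _ _) (fun k => ?_) (fun hsm => hαsum ?_) (fun k => ?_) ?_ ?_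
    · have := hα (N + k); positivity
    · rw [summable_mul_left_iff (half_pos hc).ne'] at hsm
      rw [← summable_nat_add_iff N]
      exact hsm.congr fun k => by rw [add_comm]
    · have := hα (N + k); have := hθ (N + k); positivity
    · refine Summable.mul_left _ ?_
      exact ((summable_nat_add_iff N).2 hαθ).congr fun k => by rw [add_comm k N]
    · exact hstep Ω m0 μ (ℱ.shift N) _ _ M _ _ _ hs (fun k => hα _) hcα (fun k => hθ _)
        (fun k => (hN₀ (N + k) (by omega)).1.2) (fun k => (hN₀ (N + k) (by omega)).1.1)
  have hall : ∀ᵐ ω ∂μ, ∀ N M : ℕ, N₀ ≤ N → Tendsto (fun k => truncPow n (fun k => α (N + k))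
      (fun k => θ (N + k)) M (fun k => x (N + k)) (fun k => w (N + k)) k ω) atTop (𝓝 0) := by
    rw [ae_all_iff]; intro N
    rw [ae_all_iff]; intro M
    by_cases hN : N₀ ≤ N
    · filter_upwards [key N M hN] with ω hω _ using hω
    · exact .of_forall fun ω hN' => absurd hN' hN
  filter_upwards [hall, h.ae_eventually_noise_le (by linarith) hC hα hθ hsum] with ω h1 h2
  obtain ⟨N₁, hN₁⟩ := eventually_atTop.1 h2
  set N := max N₀ N₁
  obtain ⟨M, hM⟩ := exists_nat_ge ‖x N ω‖
  -- From time `N` on the level is respected, so for this `ω` the stopped power is the true power of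
  -- the norm.
  have hgood : ∀ k, ω ∈ goodEvent (fun k => α (N + k)) (fun k => θ (N + k)) M
      (fun k => x (N + k)) (fun k => w (N + k)) k := fun k => by
    induction k with
    | zero => exact hM
    | succ k ih => exact ⟨ih, hN₁ (N + k) ((le_max_right _ _).trans (Nat.le_add_right _ _))⟩
  have h3 := h1 N M (le_max_left _ _)
  have h4 : Tendsto (fun k => ‖x (N + k) ω‖ ^ (2 * n + 2)) atTop (𝓝 0) :=
    h3.congr fun k => Set.indicator_of_mem (hgood k) _
  have h5 : Tendsto (fun k => ‖x (N + k) ω‖) atTop (𝓝 0) := by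
    have := h4.rpow_const (p := ((2 * n + 2 : ℕ) : ℝ)⁻¹) (Or.inr (by positivity))
    rw [Real.zero_rpow (by positivity)] at this
    refine this.congr fun k => ?_
    exact Real.pow_rpow_inv_natCast (norm_nonneg _) (by omega)
  rw [← tendsto_add_atTop_iff_nat N]
  refine tendsto_zero_iff_norm_tendsto_zero.2 (h5.congr fun k => by rw [add_comm])

end NoisyContraction

/-! ### Polynomial step sizes -/

section StepSize

theorem step_pos {α K : ℝ} (hα : 0 < α) (hK : 0 < K) (ξ : ℝ) (k : ℕ) :
    0 < α * ((k : ℝ) + K) ^ (-ξ) := by positivity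

theorem summable_step_rpow_iff {α K : ℝ} (hα : 0 < α) (hK : 0 < K) (ξ s : ℝ) :
    Summable (fun k : ℕ => (α * ((k : ℝ) + K) ^ (-ξ)) ^ s) ↔ 1 < ξ * s := by
  rw [← Real.summable_one_div_nat_add_rpow K (ξ * s),
    ← summable_mul_left_iff (f := fun k : ℕ => 1 / |(k : ℝ) + K| ^ (ξ * s)) (a := α ^ s)
      (by positivity)]
  refine summable_congr fun k => ?_
  have h : 0 < (k : ℝ) + K := by positivity
  rw [Real.mul_rpow hα.le (by positivity), ← Real.rpow_mul h.le, abs_of_pos h, one_div,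
    ← Real.rpow_neg h.le, neg_mul]

theorem summable_step_iff {α K : ℝ} (hα : 0 < α) (hK : 0 < K) (ξ : ℝ) :
    Summable (fun k : ℕ => α * ((k : ℝ) + K) ^ (-ξ)) ↔ 1 < ξ := by
  simpa using summable_step_rpow_iff hα hK ξ 1

theorem tendsto_natCast_add_atTop (K : ℝ) :
    Tendsto (fun k : ℕ => (k : ℝ) + K) atTop atTop :=
  tendsto_natCast_atTop_atTop.atTop_add tendsto_const_nhds

theorem tendsto_step_zero {ξ : ℝ} (α K : ℝ) (hξ : 0 < ξ) :
    Tendsto (fun k : ℕ => α * ((k : ℝ) + K) ^ (-ξ)) atTop (𝓝 0) := by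
  simpa using ((tendsto_rpow_neg_atTop hξ).comp (tendsto_natCast_add_atTop K)).const_mul α

end StepSize

/-! ### The weighted norm, the fixed point and the Lyapunov function -/

section WeightedNorm

variable {d : ℕ} {v : Fin d → ℝ}

/-- Rescaling of the coordinates, an isometry from `‖·‖_v` to the Euclidean norm. -/
noncomputable def weightScale (v : Fin d → ℝ) (hv : ∀ i, 0 < v i) :
    EuclideanSpace ℝ (Fin d) ≃L[ℝ] EuclideanSpace ℝ (Fin d) :=
  LinearEquiv.toContinuousLinearEquiv
    { toFun := fun x => WithLp.toLp 2 fun i => √(v i) * x i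
      invFun := fun x => WithLp.toLp 2 fun i => (√(v i))⁻¹ * x i
      map_add' := fun x y => by ext i; simp [mul_add]
      map_smul' := fun r x => by ext i; simp; ring
      left_inv := fun x => by
        ext i
        have := (Real.sqrt_pos.2 (hv i)).ne'
        simp [this]
      right_inv := fun x => by
        ext i
        have := (Real.sqrt_pos.2 (hv i)).ne'
        simp [this] }

theorem norm_weightScale (hv : ∀ i, 0 < v i) (x : EuclideanSpace ℝ (Fin d)) :
    ‖weightScale v hv x‖ = weightedNorm v x := by
  rw [EuclideanSpace.norm_eq, weightedNorm]
  congr 1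
  refine Finset.sum_congr rfl fun i _ => ?_
  have : (weightScale v hv x) i = √(v i) * x i := rfl
  rw [this, Real.norm_eq_abs, sq_abs, mul_pow, Real.sq_sqrt (hv i).le]

theorem norm_weightScale_le (hv : ∀ i, 0 < v i) (x : EuclideanSpace ℝ (Fin d)) :
    ‖weightScale v hv x‖ ≤
      ‖(weightScale v hv : EuclideanSpace ℝ (Fin d) →L[ℝ] EuclideanSpace ℝ (Fin d))‖ * ‖x‖ :=
  (weightScale v hv : EuclideanSpace ℝ (Fin d) →L[ℝ] EuclideanSpace ℝ (Fin d)).le_opNorm x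

theorem norm_le_weightScale (hv : ∀ i, 0 < v i) (x : EuclideanSpace ℝ (Fin d)) :
    ‖x‖ ≤ ‖((weightScale v hv).symm :
      EuclideanSpace ℝ (Fin d) →L[ℝ] EuclideanSpace ℝ (Fin d))‖ * ‖weightScale v hv x‖ := by
  simpa using ((weightScale v hv).symm :
    EuclideanSpace ℝ (Fin d) →L[ℝ] EuclideanSpace ℝ (Fin d)).le_opNorm (weightScale v hv x)

namespace IsWeightedContraction

variable {γ : ℝ} {H : EuclideanSpace ℝ (Fin d) → EuclideanSpace ℝ (Fin d)}

theorem norm_weightScale_sub_le (hH : IsWeightedContraction v γ H) (hv : ∀ i, 0 < v i)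
    (x y : EuclideanSpace ℝ (Fin d)) :
    ‖weightScale v hv (H x - H y)‖ ≤ γ * ‖weightScale v hv (x - y)‖ := by
  simpa only [norm_weightScale] using hH.contract x y

theorem continuous (hH : IsWeightedContraction v γ H) (hv : ∀ i, 0 < v i) : Continuous H := by
  have : LipschitzWith γ.toNNReal (fun z => weightScale v hv (H ((weightScale v hv).symm z))) :=
    LipschitzWith.of_dist_le_mul fun x y => by
      rw [dist_eq_norm, dist_eq_norm, ← map_sub, Real.coe_toNNReal _ hH.nonneg]
      simpa using hH.norm_weightScale_sub_le hv ((weightScale v hv).symm x)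
        ((weightScale v hv).symm y)
  have h2 := (weightScale v hv).symm.continuous.comp
    (this.continuous.comp (weightScale v hv).continuous)
  simpa [Function.comp_def] using h2

/-- Conjugating by the rescaling gives a Euclidean contraction, to which Banach's theorem applies.
-/
theorem exists_fixedPoint (hH : IsWeightedContraction v γ H) (hv : ∀ i, 0 < v i) :
    ∃ z, H z = z ∧ ∀ y, H y = y → y = z := by
  have hc : ContractingWith γ.toNNReal
      (fun z => weightScale v hv (H ((weightScale v hv).symm z))) := by
    refine ⟨Real.toNNReal_lt_one.2 hH.lt_one, LipschitzWith.of_dist_le_mul fun x y => ?_⟩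
    rw [dist_eq_norm, dist_eq_norm, ← map_sub, Real.coe_toNNReal _ hH.nonneg]
    simpa using hH.norm_weightScale_sub_le hv ((weightScale v hv).symm x)
      ((weightScale v hv).symm y)
  refine ⟨(weightScale v hv).symm hc.fixedPoint, ?_, fun y hy => ?_⟩
  · exact (weightScale v hv).injective (Eq.trans hc.fixedPoint_isFixedPt
      ((weightScale v hv).apply_symm_apply _).symm)
  · have : Function.IsFixedPt (fun z => weightScale v hv (H ((weightScale v hv).symm z)))
        (weightScale v hv y) := by simp [Function.IsFixedPt, hy]
    rw [← hc.fixedPoint_unique this]; simp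

/-- With `S` the rescaling, the gradient of `‖S x‖²` pairs with `y` to `2⟪S x, S y⟫`. Splitting `H x
- x = (H x - z) - (x - z)` and using `2ab ≤ a² + b²` bounds the drift by `‖S (H x - z)‖² - ‖S (x -
z)‖²`. -/
theorem negativeDrift (hH : IsWeightedContraction v γ H) (hv : ∀ i, 0 < v i)
    {z : EuclideanSpace ℝ (Fin d)} (hz : H z = z) :
    NegativeDrift H z (fun x => weightedNorm v x ^ 2) (1 - γ ^ 2) := by
  set S := weightScale v hv with hS
  have hd : ∀ x, HasFDerivAt (fun x => ‖S x‖ ^ 2)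
      (2 • (innerSL ℝ (S x)).comp (S : EuclideanSpace ℝ (Fin d) →L[ℝ] EuclideanSpace ℝ (Fin d)))
      x := fun x => S.hasFDerivAt.norm_sq
  have hg : ∀ x y, inner ℝ (gradient (fun x => ‖S x‖ ^ 2) x) y = 2 * inner ℝ (S x) (S y) := by
    intro x y
    rw [gradient, InnerProductSpace.toDual_symm_apply, (hd x).fderiv]
    simp
  simp only [← norm_weightScale hv]
  have hγ := hH.nonneg
  refine ⟨fun x => by positivity, fun x => (hd x).differentiableAt, ?_, fun x => ?_, ?_, ?_⟩
  · nlinarith [hH.lt_one]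
  · rw [hg]
    have h1 := hH.norm_weightScale_sub_le hv x z
    rw [hz] at h1
    have h2 : H x - x = (H x - z) - (x - z) := by abel
    have h3 := real_inner_le_norm (S (x - z)) (S (H x - z))
    have h4 : ‖S (H x - z)‖ ^ 2 ≤ (γ * ‖S (x - z)‖) ^ 2 := by gcongr
    rw [h2, map_sub S (H x - z) (x - z), inner_sub_right, real_inner_self_eq_norm_sq]
    nlinarith [sq_nonneg (‖S (x - z)‖ - ‖S (H x - z)‖)]
  -- The expansion of `‖S y‖²` around `x` is exact, with second-order term `‖S (y - x)‖²`. The added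
  -- `1`, here and in the next constants, secures positivity without a lower bound on the operator
  -- norm.
  · refine ⟨2 * (‖(S : EuclideanSpace ℝ (Fin d) →L[ℝ] EuclideanSpace ℝ (Fin d))‖ ^ 2 + 1),
      by positivity, fun x y => ?_⟩
    rw [hg]
    have h1 : S y = S x + S (y - x) := by rw [← map_add]; congr 1; abel
    have h2 := norm_weightScale_le hv (y - x)
    have h3 : ‖S (y - x)‖ ^ 2 ≤
        (‖(S : EuclideanSpace ℝ (Fin d) →L[ℝ] EuclideanSpace ℝ (Fin d))‖ * ‖y - x‖) ^ 2 := by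
      gcongr
    have h4 := norm_add_sq_real (S x) (S (y - x))
    rw [← h1] at h4
    nlinarith [sq_nonneg ‖y - x‖]
  · refine ⟨(‖(S.symm : EuclideanSpace ℝ (Fin d) →L[ℝ] EuclideanSpace ℝ (Fin d))‖ ^ 2 + 1)⁻¹,
      ‖(S : EuclideanSpace ℝ (Fin d) →L[ℝ] EuclideanSpace ℝ (Fin d))‖ ^ 2 + 1,
      by positivity, by positivity, fun x => ⟨?_, ?_⟩⟩
    · have h1 := norm_le_weightScale hv (x - z)
      rw [inv_mul_le_iff₀ (by positivity)]
      have h3 : ‖x - z‖ ^ 2 ≤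
          (‖(S.symm : EuclideanSpace ℝ (Fin d) →L[ℝ] EuclideanSpace ℝ (Fin d))‖
            * ‖S (x - z)‖) ^ 2 := by gcongr
      nlinarith [sq_nonneg ‖S (x - z)‖]
    · have h2 := norm_weightScale_le hv (x - z)
      have h3 : ‖S (x - z)‖ ^ 2 ≤
          (‖(S : EuclideanSpace ℝ (Fin d) →L[ℝ] EuclideanSpace ℝ (Fin d))‖ * ‖x - z‖) ^ 2 := by
        gcongr
      nlinarith [sq_nonneg ‖x - z‖]

/-- The weighted distance to the fixed point contracts along the noiseless step. -/
theorem norm_weightScale_step_le (hH : IsWeightedContraction v γ H) (hv : ∀ i, 0 < v i)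
    {z : EuclideanSpace ℝ (Fin d)} (hz : H z = z) {t : ℝ} (ht0 : 0 ≤ t) (ht1 : t ≤ 1)
    (x : EuclideanSpace ℝ (Fin d)) :
    ‖weightScale v hv (x - z + t • (H x - x))‖ ≤ (1 - (1 - γ) * t) * ‖weightScale v hv (x - z)‖ := by
  have h1 := hH.norm_weightScale_sub_le hv x z
  rw [hz] at h1
  have h2 : x - z + t • (H x - x) = (1 - t) • (x - z) + t • (H x - z) := by module
  rw [h2, map_add, map_smul, map_smul]
  refine (norm_add_le _ _).trans ?_
  rw [norm_smul, norm_smul, Real.norm_of_nonneg ht0, Real.norm_of_nonneg (sub_nonneg.2 ht1)]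
  nlinarith

/-- In rescaled coordinates the error is a `NoisyContraction` with rate `1 - γ`; what remains is the
choice of `θ` and `n`. -/
theorem ae_tendsto_of_mem_Ioc (hH : IsWeightedContraction v γ H) (hv : ∀ i, 0 < v i)
    {z : EuclideanSpace ℝ (Fin d)} (hz : H z = z) {p α K ξ : ℝ} (hp : 1 < p) (hα : 0 < α)
    (hK : 0 < K) (hξ : ξ ∈ Set.Ioc (1 / p) 1) {Ω : Type*} [MeasurableSpace Ω] (μ : Measure Ω)
    [IsProbabilityMeasure μ] (x w : ℕ → Ω → EuclideanSpace ℝ (Fin d))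
    (hx : ∀ k, StronglyMeasurable (x k))
    (hsa : IsStochasticApproximation H (fun k => α * ((k : ℝ) + K) ^ (-ξ)) x w)
    (hub : UnbiasedNoise μ (Filtration.natural x hx) w)
    (hmom : MomentNoise μ (Filtration.natural x hx) p z x w) :
    ∀ᵐ ω ∂μ, Tendsto (fun k => x k ω) atTop (𝓝 z) := by
  obtain ⟨A, B, hA, hB, hmom⟩ := hmom
  have hp0 : 0 < p := by linarith
  have hξ0 : 0 < ξ := lt_trans (by positivity) hξ.1
  set S := weightScale v hv with hS
  set S' := (S : EuclideanSpace ℝ (Fin d) →L[ℝ] EuclideanSpace ℝ (Fin d)) with hS'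
  set Q := (S.symm : EuclideanSpace ℝ (Fin d) →L[ℝ] EuclideanSpace ℝ (Fin d)) with hQ
  set s : ℕ → ℝ := fun k => α * ((k : ℝ) + K) ^ (-ξ) with hs
  have hs0 : ∀ k, 0 < s k := step_pos hα hK ξ
  have hslim : Tendsto s atTop (𝓝 0) := tendsto_step_zero α K hξ0
  set ℱ := Filtration.natural x hx with hℱ
  have hxm : ∀ k, StronglyMeasurable[ℱ k] (x k) := Filtration.stronglyAdapted_natural hx
  have hHm : ∀ k, StronglyMeasurable[ℱ k] fun ω => H (x k ω) := fun k =>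
    (hH.continuous hv).comp_stronglyMeasurable (hxm k)
  -- The filtration is generated by the iterates alone, but the recursion can be solved for `w k`
  -- because the step is nonzero.
  have hwm : ∀ k, StronglyMeasurable[ℱ (k + 1)] (w k) := fun k => by
    have h1 : w k = fun ω => (s k)⁻¹ • (x (k + 1) ω - x k ω) - (H (x k ω) - x k ω) := by
      ext1 ω
      have := hsa k ω
      rw [this, add_sub_cancel_left, smul_smul, inv_mul_cancel₀ (hs0 k).ne', one_smul,
        add_sub_cancel_left]
    rw [h1]
    have hm := ℱ.mono k.le_succ
    exact (((hxm (k + 1)).sub ((hxm k).mono hm)).const_smul (s k)⁻¹).sub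
      (((hHm k).mono hm).sub ((hxm k).mono hm))
  -- From `n₀` on the step is at most `1`, so a noiseless step is a convex combination of `x` and `H
  -- x`.
  obtain ⟨n₀, hn₀⟩ := eventually_atTop.1 (hslim.eventually_le_const one_pos)
  set C := ‖S'‖ ^ p * (A + B * ‖Q‖ ^ p) with hC
  have hC0 : 0 ≤ C := by positivity
  have hNC : NoisyContraction μ (ℱ.shift n₀) (1 - γ) p C (fun k => s (n₀ + k))
      (fun k ω => S (x (n₀ + k) ω - z))
      (fun k ω => S (x (n₀ + k) ω - z + s (n₀ + k) • (H (x (n₀ + k) ω) - x (n₀ + k) ω)))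
      (fun k ω => S (w (n₀ + k) ω)) := by
    refine ⟨fun k => ?_, fun k => ?_, fun k => ?_, fun k => ?_, fun k => ?_, fun k T hT => ?_,
      fun k ω => ?_, fun k ω => ?_⟩
    · exact S.continuous.comp_stronglyMeasurable ((hxm _).sub stronglyMeasurable_const)
    · exact S.continuous.comp_stronglyMeasurable (((hxm _).sub stronglyMeasurable_const).add
        (((hHm (n₀ + k)).sub (hxm (n₀ + k))).const_smul (s (n₀ + k))))
    · exact S.continuous.comp_stronglyMeasurable (hwm (n₀ + k))
    · exact S'.integrable_comp (hub _).1
    · have h1 := S'.comp_condExp_comm (m := ℱ (n₀ + k)) (hub (n₀ + k)).1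
      refine h1.symm.trans ?_
      filter_upwards [(hub (n₀ + k)).2] with ω hω
      have : (μ[w (n₀ + k) | ℱ (n₀ + k)]) ω = 0 := hω
      simp [this]
    · set j := n₀ + k
      have hT0 : MeasurableSet T := ℱ.le j _ hT
      calc ∫⁻ ω in T, ENNReal.ofReal (‖S (w j ω)‖ ^ p) ∂μ
          ≤ ∫⁻ ω in T, ENNReal.ofReal (‖S'‖ ^ p) * ENNReal.ofReal (‖w j ω‖ ^ p) ∂μ := by
            refine lintegral_mono fun ω => ?_
            rw [← ENNReal.ofReal_mul (by positivity), ← Real.mul_rpow (by positivity)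
              (by positivity)]
            gcongr
            exact norm_weightScale_le hv _
        _ = ENNReal.ofReal (‖S'‖ ^ p) * ∫⁻ ω in T, ENNReal.ofReal (‖w j ω‖ ^ p) ∂μ :=
            lintegral_const_mul' _ _ ENNReal.ofReal_ne_top
        _ = ENNReal.ofReal (‖S'‖ ^ p) *
              ∫⁻ ω in T, condLExp (ℱ j) μ (fun ω => ENNReal.ofReal (‖w j ω‖ ^ p)) ω ∂μ := by
            rw [setLIntegral_condLExp (hm := ℱ.le j) _ _ hT]
        _ ≤ ENNReal.ofReal (‖S'‖ ^ p) *
              ∫⁻ ω in T, ENNReal.ofReal (A + B * ‖x j ω - z‖ ^ p) ∂μ := by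
            refine mul_le_mul_right ?_ _
            exact lintegral_mono_ae (ae_restrict_of_ae (hmom j))
        _ = ∫⁻ ω in T, ENNReal.ofReal (‖S'‖ ^ p) *
              ENNReal.ofReal (A + B * ‖x j ω - z‖ ^ p) ∂μ :=
            (lintegral_const_mul' _ _ ENNReal.ofReal_ne_top).symm
        _ ≤ _ := by
            refine lintegral_mono fun ω => ?_
            rw [← ENNReal.ofReal_mul (by positivity)]
            refine ENNReal.ofReal_le_ofReal ?_
            rw [hC, mul_assoc]
            set Y := ‖S (x j ω - z)‖
            have h1 : ‖x j ω - z‖ ^ p ≤ ‖Q‖ ^ p * (1 + Y) ^ p := by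
              rw [← Real.mul_rpow (by positivity) (by positivity)]
              have : ‖x j ω - z‖ ≤ ‖Q‖ * Y := norm_le_weightScale hv _
              gcongr
              refine this.trans ?_
              gcongr
              linarith
            have h2 : 1 ≤ (1 + Y) ^ p := Real.one_le_rpow (by
              have : 0 ≤ Y := norm_nonneg _
              linarith) hp0.le
            gcongr
            calc A + B * ‖x j ω - z‖ ^ p ≤ A * (1 + Y) ^ p + B * (‖Q‖ ^ p * (1 + Y) ^ p) := by
                  gcongr
                  exact le_mul_of_one_le_right hA.le h2
              _ = _ := by ring
    · have := hsa (n₀ + k) ω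
      rw [show n₀ + (k + 1) = n₀ + k + 1 by ring, this, ← map_smul, ← map_add]
      congr 1
      rw [smul_add]
      abel
    · exact hH.norm_weightScale_step_le hv hz (hs0 _).le (hn₀ _ (Nat.le_add_right _ _)) _
  -- `ρ > 1/ξ` makes `∑ s^ρ` finite, and `ρ < p` makes `κ` positive, so that `θ → 0`. Since `ξ ≤ 1`,
  -- also `ρ > 1`, which the threshold condition needs.
  obtain ⟨ρ, hρ1, hρp⟩ := exists_between (show 1 / ξ < p by
    rw [div_lt_iff₀ hξ0]
    have := (div_lt_iff₀ hp0).1 hξ.1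
    linarith)
  have hρξ : 1 < ξ * ρ := by
    have := (div_lt_iff₀ hξ0).1 hρ1
    linarith
  have hρ : 1 < ρ := by
    have : 0 < ρ := lt_trans (by positivity) hρ1
    nlinarith [hξ.2]
  set κ := 1 - ρ / p with hκ
  have hκ0 : 0 < κ := by rw [hκ, sub_pos, div_lt_one hp0]; exact hρp
  obtain ⟨n, hn⟩ := exists_nat_gt (1 / (ξ * κ))
  have hnκ : 1 < ξ * (1 + (n + 1) * κ) := by
    rw [div_lt_iff₀ (by positivity)] at hn
    nlinarith [mul_pos hξ0 hκ0]
  have hsh : ∀ {f : ℕ → ℝ}, Summable f → Summable fun k => f (n₀ + k) := fun {f} hf =>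
    ((summable_nat_add_iff n₀).2 hf).congr fun k => by rw [add_comm]
  have hlim : Tendsto (fun k => s (n₀ + k)) atTop (𝓝 0) := by
    have := (tendsto_add_atTop_iff_nat n₀).2 hslim
    exact this.congr fun k => by rw [add_comm]
  have main := hNC.ae_tendsto_zero (θ := fun k => s (n₀ + k) ^ κ) (sub_pos.2 hH.lt_one) hp.le hC0 n
    (fun k => hs0 _) (fun k => Real.rpow_pos_of_pos (hs0 _) _) hlim
    (by simpa [hκ0.ne'] using hlim.rpow_const (p := κ) (Or.inr hκ0.le))
    (.of_forall fun k r hr => by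
      have hs1 := hs0 (n₀ + k)
      have hle : s (n₀ + k) ≤ 1 := hn₀ _ (Nat.le_add_right _ _)
      set t := s (n₀ + k)
      have h1 : t ^ (κ - 1) ≤ r := by rwa [Real.rpow_sub_one hs1.ne']
      have hr0 : 0 < r := lt_of_lt_of_le (by positivity) h1
      -- The exponents compare as `(κ - 1)(p - 1) ≤ -κ`, which amounts to `ρ ≥ 1`.
      have h2 : t ^ (-κ) ≤ r ^ (p - 1) := by
        calc t ^ (-κ) ≤ t ^ ((κ - 1) * (p - 1)) := by
              refine Real.rpow_le_rpow_of_exponent_ge hs1 hle ?_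
              have : ρ / p * p = ρ := div_mul_cancel₀ _ hp0.ne'
              rw [hκ]
              nlinarith
          _ = (t ^ (κ - 1)) ^ (p - 1) := Real.rpow_mul hs1.le _ _
          _ ≤ r ^ (p - 1) := Real.rpow_le_rpow (by positivity) h1 (by linarith)
      have h3 : 1 ≤ t ^ κ * r ^ (p - 1) := by
        calc (1 : ℝ) = t ^ κ * t ^ (-κ) := by rw [← Real.rpow_add hs1]; simp
          _ ≤ _ := by gcongr
      calc r = 1 * r := (one_mul r).symm
        _ ≤ t ^ κ * r ^ (p - 1) * r := by gcongr
        _ = t ^ κ * r ^ p := by rw [mul_assoc, Real.rpow_sub_one hr0.ne', div_mul_cancel₀ _ hr0.ne'])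
    (fun hcon => by
      have : Summable s := (summable_nat_add_iff n₀).1 (hcon.congr fun k => by rw [add_comm])
      exact absurd ((summable_step_iff hα hK ξ).1 this) (not_lt.2 hξ.2))
    (by
      refine (hsh ((summable_step_rpow_iff hα hK ξ _).2 hnκ)).congr fun k => ?_
      show s (n₀ + k) ^ (1 + ((n : ℝ) + 1) * κ) = s (n₀ + k) * (s (n₀ + k) ^ κ) ^ (n + 1)
      have h1 := hs0 (n₀ + k)
      rw [Real.rpow_add h1, Real.rpow_one, ← Real.rpow_natCast, ← Real.rpow_mul h1.le]
      push_cast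
      ring_nf)
    (by
      refine (hsh ((summable_step_rpow_iff hα hK ξ ρ).2 hρξ)).congr fun k => ?_
      show s (n₀ + k) ^ ρ = (s (n₀ + k) / s (n₀ + k) ^ κ) ^ p
      have h1 := hs0 (n₀ + k)
      rw [← Real.rpow_one_sub' h1.le (by rw [hκ]; have : 0 < ρ / p := by positivity
                                         linarith), ← Real.rpow_mul h1.le]
      congr 1
      rw [hκ]
      field_simp
      ring)
  filter_upwards [main] with ω hω
  have h1 : Tendsto (fun k => S.symm (S (x (n₀ + k) ω - z)) + z) atTop (𝓝 (S.symm 0 + z)) :=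
    ((S.symm.continuous.tendsto 0).comp hω).add_const z
  simp only [ContinuousLinearEquiv.symm_apply_apply, sub_add_cancel, map_zero, zero_add] at h1
  rw [← tendsto_add_atTop_iff_nat n₀]
  exact h1.congr fun k => by rw [add_comm]

end IsWeightedContraction
end WeightedNorm

/-! ### Construction of noise with independent symmetric jumps -/

section

theorem condLExp_indep_eq {Ω : Type*} {m₁ m₂ m : MeasurableSpace Ω} {μ : Measure Ω}
    [IsProbabilityMeasure μ] (hle₁ : m₁ ≤ m) (hle₂ : m₂ ≤ m) {f : Ω → ℝ≥0∞}
    (hf : Measurable[m₁] f) (hindp : Indep m₁ m₂ μ) :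
    condLExp m₂ μ f =ᵐ[μ] fun _ => ∫⁻ ω, f ω ∂μ := by
  refine (ae_eq_condLExp (hm := hle₂) μ f measurable_const fun S hS => ?_).symm
  have hg : Measurable[m₂] (S.indicator (1 : Ω → ℝ≥0∞)) := by
    refine Measurable.indicator ?_ hS
    exact measurable_const
  have h := lintegral_mul_eq_lintegral_mul_lintegral_of_independent_measurableSpace hle₁ hle₂ hindp
    hf hg
  rw [lintegral_indicator_one (hle₂ _ hS)] at h
  rw [setLIntegral_const, ← h, ← lintegral_indicator (hle₂ _ hS)]
  refine lintegral_congr fun ω => ?_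
  by_cases hω : ω ∈ S <;> simp [hω]

/-- The law on `{-1, 0, 1}` giving mass `q / 2` to each of `1` and `-1`. -/
noncomputable def symmetricJump (q : ℝ) : Measure ℝ :=
  ENNReal.ofReal (1 - q) • Measure.dirac 0 + (ENNReal.ofReal (q / 2) • Measure.dirac 1 +
    ENNReal.ofReal (q / 2) • Measure.dirac (-1))

theorem lintegral_symmetricJump (q : ℝ) (f : ℝ → ℝ≥0∞) :
    ∫⁻ t, f t ∂symmetricJump q = ENNReal.ofReal (1 - q) * f 0 +
      (ENNReal.ofReal (q / 2) * f 1 + ENNReal.ofReal (q / 2) * f (-1)) := by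
  simp [symmetricJump, lintegral_add_measure, lintegral_smul_measure]

theorem isProbabilityMeasure_symmetricJump {q : ℝ} (hq0 : 0 ≤ q) (hq1 : q ≤ 1) :
    IsProbabilityMeasure (symmetricJump q) := by
  constructor
  rw [← lintegral_one, lintegral_symmetricJump]
  rw [mul_one, mul_one, ← ENNReal.ofReal_add (by linarith) (by linarith),
    ← ENNReal.ofReal_add (by linarith) (by linarith)]
  simp

theorem ae_symmetricJump (q : ℝ) : ∀ᵐ t ∂symmetricJump q, t = 0 ∨ |t| = 1 :=
  ae_add_measure_iff.2 ⟨Measure.ae_smul_measure (by simp) _, ae_add_measure_iff.2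
    ⟨Measure.ae_smul_measure (by simp) _, Measure.ae_smul_measure (by simp) _⟩⟩

theorem integrable_symmetricJump (q : ℝ) : Integrable (fun t => t) (symmetricJump q) :=
  ((integrable_dirac (by simp)).smul_measure ENNReal.ofReal_ne_top).add_measure
    (((integrable_dirac (by simp)).smul_measure ENNReal.ofReal_ne_top).add_measure
      ((integrable_dirac (by simp)).smul_measure ENNReal.ofReal_ne_top))

theorem integral_symmetricJump (q : ℝ) : ∫ t, t ∂symmetricJump q = 0 := by
  have h : ∀ (r a : ℝ), Integrable (fun t : ℝ => t) (ENNReal.ofReal r • Measure.dirac a) :=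
    fun r a => (integrable_dirac (by simp)).smul_measure ENNReal.ofReal_ne_top
  rw [symmetricJump, integral_add_measure (h _ _) ((h _ _).add_measure (h _ _)),
    integral_add_measure (h _ _) (h _ _)]
  simp

theorem exists_iIndepFun_symmetricJump (q : ℕ → ℝ) (hq0 : ∀ k, 0 ≤ q k) (hq1 : ∀ k, q k ≤ 1) :
    ∃ (Ω : Type u) (_ : MeasurableSpace Ω) (μ : Measure Ω) (_ : IsProbabilityMeasure μ)
      (ε : ℕ → Ω → ℝ), (∀ k, Measurable (ε k)) ∧ iIndepFun ε μ ∧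
        ∀ k, μ.map (ε k) = symmetricJump (q k) := by
  have := fun k => isProbabilityMeasure_symmetricJump (hq0 k) (hq1 k)
  -- Lifting the real line places the sample space in the prescribed universe.
  obtain ⟨Ω, mΩ, μ, X, hXm, hXl, hXi, hμ⟩ := exists_hasLaw_indepFun (fun _ : ℕ => ULift.{u} ℝ)
    (fun k => (symmetricJump (q k)).map ULift.up)
  refine ⟨Ω, mΩ, μ, hμ, fun k ω => (X k ω).down, fun k => measurable_down.comp (hXm k), ?_,
    fun k => ?_⟩
  · exact hXi.comp (fun _ => ULift.down) fun _ => measurable_down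
  · show μ.map (ULift.down ∘ X k) = _
    rw [← Measure.map_map measurable_down (hXm k), (hXl k).map_eq,
      Measure.map_map measurable_down measurable_up]
    exact Measure.map_id

end

section

variable {E : Type*} [NormedAddCommGroup E] [NormedSpace ℝ E] {Ω : Type*}

/-- The stochastic approximation process started at `z` and driven by the noise `w`. -/
def approxProcess (H : E → E) (s : ℕ → ℝ) (z : E) (w : ℕ → Ω → E) : ℕ → Ω → E
  | 0 => fun _ => z
  | k + 1 => fun ω => approxProcess H s z w k ω +
      s k • (H (approxProcess H s z w k ω) - approxProcess H s z w k ω + w k ω)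

theorem stronglyMeasurable_approxProcess {m0 : MeasurableSpace Ω} {ℱ : Filtration ℕ m0} {H : E → E}
    (hH : Continuous H) (s : ℕ → ℝ) (z : E) {w : ℕ → Ω → E}
    (hw : ∀ k, StronglyMeasurable[ℱ (k + 1)] (w k)) (k : ℕ) :
    StronglyMeasurable[ℱ k] (approxProcess H s z w k) := by
  induction k with
  | zero => exact stronglyMeasurable_const
  | succ k ih =>
    have h := ih.mono (ℱ.mono k.le_succ)
    exact h.add ((((hH.comp_stronglyMeasurable h).sub h).add (hw k)).const_smul (s k))

end

/-- A stochastic approximation process started at `z`, whose noise has norm `r k` on independent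
events `J k` of probability `q k` and vanishes off these events. -/
theorem exists_stochasticApproximation {d : ℕ} (hd : 0 < d)
    {H : EuclideanSpace ℝ (Fin d) → EuclideanSpace ℝ (Fin d)} (hH : Continuous H) (s : ℕ → ℝ)
    (z : EuclideanSpace ℝ (Fin d)) {p : ℝ} (hp : 0 < p) {q r : ℕ → ℝ} (hq0 : ∀ k, 0 ≤ q k)
    (hq1 : ∀ k, q k ≤ 1) (hr : ∀ k, 0 ≤ r k) (hqr : ∀ k, q k * r k ^ p ≤ 1) :
    ∃ (Ω : Type u) (_ : MeasurableSpace Ω) (μ : Measure Ω) (_ : IsProbabilityMeasure μ)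
      (x w : ℕ → Ω → EuclideanSpace ℝ (Fin d)) (hx : ∀ k, StronglyMeasurable (x k))
      (J : ℕ → Set Ω),
      IsStochasticApproximation H s x w ∧ UnbiasedNoise μ (Filtration.natural x hx) w ∧
      MomentNoise μ (Filtration.natural x hx) p z x w ∧ (∀ ω, x 0 ω = z) ∧
      (∀ k, MeasurableSet (J k)) ∧ iIndepSet J μ ∧ (∀ k, μ (J k) = ENNReal.ofReal (q k)) ∧
      ∀ᵐ ω ∂μ, ∀ k, (ω ∈ J k → ‖w k ω‖ = r k) ∧ (ω ∉ J k → w k ω = 0) := by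
  -- The index is shifted: `w k` uses `ε (k + 1)`, hence is independent of `ε 0, …, ε k`, which
  -- determine `x k`. The variable `ε 0` drives nothing.
  obtain ⟨Ω, mΩ, μ, hμ, ε, hεm, hεi, hεl⟩ :=
    exists_iIndepFun_symmetricJump.{u} (fun k => q (k - 1)) (fun k => hq0 _) (fun k => hq1 _)
  have hεl' : ∀ k, μ.map (ε (k + 1)) = symmetricJump (q k) := fun k => hεl (k + 1)
  set e : EuclideanSpace ℝ (Fin d) := EuclideanSpace.single ⟨0, hd⟩ 1 with he
  have he1 : ‖e‖ = 1 := by simp [he]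
  set w : ℕ → Ω → EuclideanSpace ℝ (Fin d) := fun k ω => (r k * ε (k + 1) ω) • e with hw
  have hnw : ∀ k ω, ‖w k ω‖ = r k * |ε (k + 1) ω| := fun k ω => by
    rw [hw, norm_smul, he1, mul_one, norm_mul, Real.norm_of_nonneg (hr k), Real.norm_eq_abs]
  have hεs : ∀ k, StronglyMeasurable (ε k) := fun k => (hεm k).stronglyMeasurable
  set 𝒢 := Filtration.natural ε hεs with h𝒢
  have hεa : ∀ k, StronglyMeasurable[𝒢 k] (ε k) := Filtration.stronglyAdapted_natural hεs
  have hwa : ∀ k, StronglyMeasurable[𝒢 (k + 1)] (w k) := fun k =>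
    ((hεa (k + 1)).const_mul (r k)).smul_const e
  set x := approxProcess H s z w with hx
  have hxa : ∀ k, StronglyMeasurable[𝒢 k] (x k) := stronglyMeasurable_approxProcess hH s z hwa
  have hxs : ∀ k, StronglyMeasurable (x k) := fun k => (hxa k).mono (𝒢.le k)
  have hle : ∀ k, Filtration.natural x hxs k ≤ 𝒢 k := fun k =>
    iSup₂_le fun j hj => ((hxa j).measurable.mono (𝒢.mono hj) le_rfl).comap_le
  have hind : ∀ k, Indep (MeasurableSpace.comap (ε (k + 1)) inferInstance)
      (Filtration.natural x hxs k) μ := fun k =>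
    indep_of_indep_of_le_right (hεi.indep_comap_natural_of_lt hεs k.lt_succ_self) (hle k)
  have hcm : ∀ k, Measurable[MeasurableSpace.comap (ε (k + 1)) inferInstance] (ε (k + 1)) :=
    fun k => comap_measurable _
  have hεint : ∀ k, Integrable (ε (k + 1)) μ := fun k => by
    have := integrable_symmetricJump (q k)
    rw [← hεl' k] at this
    exact this.comp_measurable (hεm _)
  -- The moment constants are `A = 1`, `B = 0`, because the conditional `p`-th moment is the
  -- constant `q k * r k ^ p ≤ 1`.
  refine ⟨Ω, mΩ, μ, hμ, x, w, hxs, fun k => {ω | ε (k + 1) ω ≠ 0}, fun k ω => rfl, fun k => ⟨?_, ?_⟩,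
    ⟨1, 0, one_pos, le_rfl, fun k => ?_⟩, fun ω => rfl, fun k => ?_, ?_, fun k => ?_, ?_⟩
  · exact ((hεint k).const_mul (r k)).smul_const e
  · refine (condExp_indep_eq (hεm (k + 1)).comap_le ((Filtration.natural x hxs).le k) ?_
      (hind k)).trans ?_
    · exact (((hcm k).const_mul (r k)).stronglyMeasurable).smul_const e
    · refine .of_forall fun ω => ?_
      have h0 : ∫ ω, ε (k + 1) ω ∂μ = 0 := by
        rw [← integral_symmetricJump (q k), ← hεl' k]
        exact (integral_map (hεm _).aemeasurable aestronglyMeasurable_id).symm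
      show ∫ ω, (r k * ε (k + 1) ω) • e ∂μ = 0
      rw [integral_smul_const, integral_const_mul, h0, mul_zero, zero_smul]
  · refine (condLExp_indep_eq (hεm (k + 1)).comap_le ((Filtration.natural x hxs).le k) ?_
      (hind k)).le.trans (.of_forall fun ω => ?_)
    · simp only [hnw]
      have h1 : Measurable fun t : ℝ => ENNReal.ofReal ((r k * |t|) ^ p) := by fun_prop
      exact h1.comp (hcm k)
    · simp only [hnw]
      have h1 : Measurable fun t : ℝ => ENNReal.ofReal ((r k * |t|) ^ p) := by fun_prop
      have h2 := lintegral_map (μ := μ) h1 (hεm (k + 1))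
      rw [← h2, hεl' k, lintegral_symmetricJump, zero_mul, add_zero]
      simp only [abs_zero, mul_zero, Real.zero_rpow hp.ne', ENNReal.ofReal_zero, abs_one, abs_neg,
        mul_one, zero_add]
      rw [← add_mul, ← ENNReal.ofReal_add (by have := hq0 k; positivity)
        (by have := hq0 k; positivity), add_halves, ← ENNReal.ofReal_mul (hq0 k)]
      exact ENNReal.ofReal_le_ofReal (hqr k)
  · exact (hεm (k + 1)) (measurableSet_singleton 0).compl
  · have h1 : iIndepFun (fun k => ε (k + 1)) μ := hεi.precomp (add_left_injective 1)
    refine (iIndepSet_iff_meas_biInter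
      fun k => (hεm (k + 1)) (measurableSet_singleton 0).compl).2 fun T => ?_
    exact h1.measure_inter_preimage_eq_mul T (sets := fun _ => {0}ᶜ)
      fun k _ => (measurableSet_singleton 0).compl
  · have hm : MeasurableSet ({0}ᶜ : Set ℝ) := (measurableSet_singleton 0).compl
    show μ (ε (k + 1) ⁻¹' {0}ᶜ) = _
    rw [← Measure.map_apply (hεm _) hm, hεl' k, ← lintegral_indicator_one hm,
      lintegral_symmetricJump]
    simp only [Set.mem_compl_iff, Set.mem_singleton_iff, not_true_eq_false, not_false_eq_true,
      Set.indicator_of_notMem, one_ne_zero, neg_eq_zero, Set.indicator_of_mem, Pi.one_apply,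
      mul_zero, mul_one, zero_add]
    rw [← ENNReal.ofReal_add (by have := hq0 k; positivity)
        (by have := hq0 k; positivity), add_halves]
  · rw [ae_all_iff]
    intro k
    have h1 := ae_symmetricJump (q k)
    rw [← hεl' k] at h1
    filter_upwards [ae_of_ae_map (hεm _).aemeasurable h1] with ω hω
    constructor
    · intro hJ
      rw [hnw, hω.resolve_left hJ, mul_one]
    · intro hJ
      have : ε (k + 1) ω = 0 := not_not.1 hJ
      simp [hw, this]

/-! ### Failure of convergence outside the range -/

namespace IsWeightedContraction

variable {d : ℕ} {v : Fin d → ℝ} {γ : ℝ}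
  {H : EuclideanSpace ℝ (Fin d) → EuclideanSpace ℝ (Fin d)}

/-- By the second Borel–Cantelli lemma the jumps occur infinitely often, and each displaces the
iterate by a vector of norm `b`. Convergence would force `s k • w k → 0`. Dividing by the bound `b`
keeps `(s k / b)^p` a probability. -/
theorem exists_not_tendsto_of_not_summable (hH : IsWeightedContraction v γ H) (hv : ∀ i, 0 < v i)
    (hd : 0 < d) {z : EuclideanSpace ℝ (Fin d)} (hz : H z = z) {p : ℝ} (hp : 0 < p) {s : ℕ → ℝ}
    (hs0 : ∀ k, 0 < s k) {b : ℝ} (hsb : ∀ k, s k ≤ b) (hs : ¬ Summable fun k => s k ^ p) :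
    ∃ (Ω : Type u) (_ : MeasurableSpace Ω) (μ : Measure Ω) (_ : IsProbabilityMeasure μ)
      (x w : ℕ → Ω → EuclideanSpace ℝ (Fin d)) (hx : ∀ k, StronglyMeasurable (x k)),
      IsStochasticApproximation H s x w ∧ UnbiasedNoise μ (Filtration.natural x hx) w ∧
      MomentNoise μ (Filtration.natural x hx) p z x w ∧
      ¬ ∀ᵐ ω ∂μ, Tendsto (fun k => x k ω) atTop (𝓝 z) := by
  have hb : 0 < b := (hs0 0).trans_le (hsb 0)
  obtain ⟨Ω, mΩ, μ, hμ, x, w, hx, J, hsa, hub, hmom, -, hJm, hJi, hJq, hJw⟩ :=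
    exists_stochasticApproximation.{u} hd (hH.continuous hv) s z hp
      (q := fun k => (s k / b) ^ p) (r := fun k => b / s k)
      (fun k => by have := hs0 k; positivity)
      (fun k => Real.rpow_le_one (by have := hs0 k; positivity) ((div_le_one hb).2 (hsb k)) hp.le)
      (fun k => by have := hs0 k; positivity)
      (fun k => by
        have := hs0 k
        rw [← Real.mul_rpow (by positivity) (by positivity), div_mul_div_comm, mul_comm (s k),
          div_self (by positivity), Real.one_rpow])
  refine ⟨Ω, mΩ, μ, hμ, x, w, hx, hsa, hub, hmom, fun hconv => ?_⟩
  have hsum : ∑' k, μ (J k) = ∞ := by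
    simp only [hJq]
    by_contra hne
    refine hs ?_
    have h1 := ENNReal.summable_toReal hne
    have h2 : Summable fun k => (s k / b) ^ p := h1.congr fun k =>
      ENNReal.toReal_ofReal (by have := hs0 k; positivity)
    refine (h2.mul_left (b ^ p)).congr fun k => ?_
    have := hs0 k
    rw [← Real.mul_rpow hb.le (by positivity), mul_div_cancel₀ _ hb.ne']
  have hlim := measure_limsup_eq_one hJm hJi hsum
  have hio : ∀ᵐ ω ∂μ, ω ∈ limsup J atTop :=
    (mem_ae_iff_prob_eq_one (MeasurableSet.measurableSet_limsup hJm)).2 hlim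
  obtain ⟨ω, h1, h2, h3⟩ := (hconv.and (hio.and hJw)).exists
  rw [mem_limsup_iff_frequently_mem] at h2
  have hdiff : Tendsto (fun k => x (k + 1) ω - x k ω) atTop (𝓝 0) := by
    simpa using ((tendsto_add_atTop_iff_nat 1).2 h1).sub h1
  have hHd : Tendsto (fun k => H (x k ω) - x k ω) atTop (𝓝 0) := by
    have := (((hH.continuous hv).tendsto z).comp h1).sub h1
    simpa [hz] using this
  have hsH : Tendsto (fun k => s k • (H (x k ω) - x k ω)) atTop (𝓝 0) := by
    refine squeeze_zero_norm (fun k => ?_) (by simpa using hHd.norm.const_mul b)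
    rw [norm_smul, Real.norm_of_nonneg (hs0 k).le]
    gcongr
    exact hsb k
  have hsw : Tendsto (fun k => ‖s k • w k ω‖) atTop (𝓝 0) := by
    have := (hdiff.sub hsH).norm
    rw [sub_zero, norm_zero] at this
    refine this.congr fun k => ?_
    rw [hsa k ω, smul_add]
    congr 1
    abel
  have hev := hsw.eventually_lt_const hb
  obtain ⟨k, hk1, hk2⟩ := (h2.and_eventually hev).exists
  rw [norm_smul, (h3 k).1 hk1, Real.norm_of_nonneg (hs0 k).le, mul_div_cancel₀ _ (hs0 k).ne'] at hk2
  exact lt_irrefl _ hk2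

/-- A single random kick at time `n` moves the process away from the fixed point for good, if the
noiseless steps after time `n` do not bring it back. -/
theorem exists_not_tendsto_of_expanding (hH : IsWeightedContraction v γ H) (hv : ∀ i, 0 < v i)
    (hd : 0 < d) {z : EuclideanSpace ℝ (Fin d)} (hz : H z = z) {p : ℝ} (hp : 0 < p) {s : ℕ → ℝ}
    (hs0 : ∀ k, 0 < s k) {δ : ℕ → ℝ} (hδ : ∀ k, 0 ≤ δ k) (n : ℕ)
    (hδs : ∀ N, ∑ k ∈ Finset.range N, δ (n + 1 + k) ≤ 1 / 2)
    (hexp : ∀ k, n < k → ∀ x, (1 - δ k) * ‖weightScale v hv (x - z)‖ ≤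
      ‖weightScale v hv (x - z + s k • (H x - x))‖) :
    ∃ (Ω : Type u) (_ : MeasurableSpace Ω) (μ : Measure Ω) (_ : IsProbabilityMeasure μ)
      (x w : ℕ → Ω → EuclideanSpace ℝ (Fin d)) (hx : ∀ k, StronglyMeasurable (x k)),
      IsStochasticApproximation H s x w ∧ UnbiasedNoise μ (Filtration.natural x hx) w ∧
      MomentNoise μ (Filtration.natural x hx) p z x w ∧
      ¬ ∀ᵐ ω ∂μ, Tendsto (fun k => x k ω) atTop (𝓝 z) := by
  obtain ⟨Ω, mΩ, μ, hμ, x, w, hx, J, hsa, hub, hmom, hx0, hJm, hJi, hJq, hJw⟩ :=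
    exists_stochasticApproximation.{u} hd (hH.continuous hv) s z hp
      -- The kick at time `n` is certain and has norm `1`, only its sign being random; all other
      -- noise vanishes.
      (q := fun k => if k = n then 1 else 0) (r := fun _ => 1)
      (fun k => by split_ifs <;> norm_num) (fun k => by split_ifs <;> norm_num)
      (fun k => zero_le_one) (fun k => by split_ifs <;> norm_num)
  refine ⟨Ω, mΩ, μ, hμ, x, w, hx, hsa, hub, hmom, fun hconv => ?_⟩
  have hJn : ∀ᵐ ω ∂μ, ω ∈ J n := (mem_ae_iff_prob_eq_one (hJm n)).2 (by simp [hJq])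
  have hJk : ∀ᵐ ω ∂μ, ∀ k, k ≠ n → ω ∉ J k := by
    rw [ae_all_iff]
    intro k
    by_cases hk : k = n
    · exact .of_forall fun ω h => absurd hk h
    · have : μ (J k) = 0 := by simp [hJq, hk]
      filter_upwards [measure_eq_zero_iff_ae_notMem.1 this] with ω hω _ using hω
  obtain ⟨ω, h1, h2, h3, h4⟩ := (hconv.and (hJn.and (hJk.and hJw))).exists
  have hw0 : ∀ k, k ≠ n → w k ω = 0 := fun k hk => (h4 k).2 (h3 k hk)
  have hxz : ∀ k, k ≤ n → x k ω = z := fun k hk => by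
    induction k with
    | zero => exact hx0 ω
    | succ k ih =>
      rw [hsa k ω, ih (by omega), hz, hw0 k (by omega)]
      simp
  have hx1 : x (n + 1) ω - z = s n • w n ω := by
    rw [hsa n ω, hxz n le_rfl, hz]; simp
  have hne : 0 < ‖weightScale v hv (x (n + 1) ω - z)‖ := by
    rw [norm_pos_iff, EmbeddingLike.map_ne_zero_iff, hx1, ← norm_pos_iff, norm_smul,
      (h4 n).1 h2, mul_one, Real.norm_of_nonneg (hs0 n).le]
    exact hs0 n
  set c := ‖weightScale v hv (x (n + 1) ω - z)‖ with hc
  -- This is `∏ (1 - δ) ≥ 1 - ∑ δ`, so at least half of the initial distance survives.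
  have hlow : ∀ N, (1 - ∑ k ∈ Finset.range N, δ (n + 1 + k)) * c ≤
      ‖weightScale v hv (x (n + 1 + N) ω - z)‖ := fun N => by
    induction N with
    | zero => simp [hc]
    | succ N ih =>
      have h5 := hexp (n + 1 + N) (by omega) (x (n + 1 + N) ω)
      have h6 : x (n + 1 + (N + 1)) ω - z = x (n + 1 + N) ω - z +
          s (n + 1 + N) • (H (x (n + 1 + N) ω) - x (n + 1 + N) ω) := by
        rw [show n + 1 + (N + 1) = n + 1 + N + 1 by ring, hsa, hw0 _ (by omega), add_zero]
        abel
      rw [h6]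
      refine le_trans ?_ h5
      set σ := ∑ k ∈ Finset.range N, δ (n + 1 + k) with hσ
      have h7 := hδs (N + 1)
      have hσ0 : 0 ≤ σ := Finset.sum_nonneg fun k _ => hδ _
      rw [Finset.sum_range_succ, ← hσ] at h7 ⊢
      have h8 : 0 ≤ δ (n + 1 + N) := hδ _
      calc (1 - (σ + δ (n + 1 + N))) * c
          ≤ (1 - δ (n + 1 + N)) * ((1 - σ) * c) := by
            nlinarith [mul_nonneg (mul_nonneg h8 hσ0) hne.le]
        _ ≤ _ := by gcongr; linarith
  have hlim : Tendsto (fun N => ‖weightScale v hv (x (n + 1 + N) ω - z)‖) atTop (𝓝 0) := by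
    have h5 : Tendsto (fun N => x (n + 1 + N) ω) atTop (𝓝 z) :=
      ((tendsto_add_atTop_iff_nat (n + 1)).2 h1).congr fun N => by rw [add_comm]
    have h6 := (((weightScale v hv).continuous.tendsto _).comp (h5.sub_const z)).norm
    simpa using h6
  obtain ⟨N, hN⟩ := (hlim.eventually_lt_const (half_pos hne)).exists
  have h5 := hlow N
  have h6 := hδs N
  nlinarith

/-- `H x - x` is at most twice as long as `x - z`, so a step of size `t` removes at most the
fraction `2t` of the distance. -/
theorem sub_le_norm_weightScale_step (hH : IsWeightedContraction v γ H) (hv : ∀ i, 0 < v i)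
    {z : EuclideanSpace ℝ (Fin d)} (hz : H z = z) {t : ℝ} (ht : 0 ≤ t)
    (x : EuclideanSpace ℝ (Fin d)) :
    (1 - 2 * t) * ‖weightScale v hv (x - z)‖ ≤ ‖weightScale v hv (x - z + t • (H x - x))‖ := by
  have h1 := hH.norm_weightScale_sub_le hv x z
  rw [hz] at h1
  have h2 : x - z = (x - z + t • (H x - x)) + t • (x - z) - t • (H x - z) := by module
  have h3 : ‖weightScale v hv (x - z)‖ ≤ ‖weightScale v hv (x - z + t • (H x - x))‖ +
      t * ‖weightScale v hv (x - z)‖ + t * ‖weightScale v hv (H x - z)‖ := by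
    conv_lhs => rw [h2, map_sub, map_add, map_smul, map_smul]
    refine (norm_sub_le _ _).trans ?_
    rw [norm_smul t (weightScale v hv (H x - z)), Real.norm_of_nonneg ht]
    gcongr
    refine (norm_add_le _ _).trans ?_
    rw [norm_smul, Real.norm_of_nonneg ht]
  have h4 : ‖weightScale v hv (H x - z)‖ ≤ ‖weightScale v hv (x - z)‖ :=
    h1.trans (mul_le_of_le_one_left (norm_nonneg _) hH.lt_one.le)
  nlinarith

/-- For large `t` the step overshoots: `t (x - z)` dominates the other terms and leaves at least `t
(1 - γ) - 1 ≥ 1` times the old distance. -/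
theorem le_norm_weightScale_step (hH : IsWeightedContraction v γ H) (hv : ∀ i, 0 < v i)
    {z : EuclideanSpace ℝ (Fin d)} (hz : H z = z) {t : ℝ} (ht : 2 ≤ t * (1 - γ))
    (x : EuclideanSpace ℝ (Fin d)) :
    ‖weightScale v hv (x - z)‖ ≤ ‖weightScale v hv (x - z + t • (H x - x))‖ := by
  have hγ : 0 < 1 - γ := sub_pos.2 hH.lt_one
  have ht0 : 0 < t := by
    by_contra hcon
    nlinarith [mul_nonneg (neg_nonneg.2 (not_lt.1 hcon)) hγ.le]
  have h1 := hH.norm_weightScale_sub_le hv x z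
  rw [hz] at h1
  have h2 : t • (x - z) = (x - z) + t • (H x - z) - (x - z + t • (H x - x)) := by module
  have h3 : t * ‖weightScale v hv (x - z)‖ ≤ ‖weightScale v hv (x - z)‖ +
      t * ‖weightScale v hv (H x - z)‖ + ‖weightScale v hv (x - z + t • (H x - x))‖ := by
    have : ‖weightScale v hv (t • (x - z))‖ = t * ‖weightScale v hv (x - z)‖ := by
      rw [map_smul, norm_smul, Real.norm_of_nonneg ht0.le]
    rw [← this, h2, map_sub, map_add, map_smul]
    refine (norm_sub_le _ _).trans ?_
    gcongr
    refine (norm_add_le _ _).trans ?_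
    rw [norm_smul, Real.norm_of_nonneg ht0.le]
  have h4 : t * ‖weightScale v hv (H x - z)‖ ≤ t * (γ * ‖weightScale v hv (x - z)‖) := by gcongr
  nlinarith [norm_nonneg (weightScale v hv (x - z))]

theorem exists_not_tendsto_of_notMem_Ioc (hH : IsWeightedContraction v γ H) (hv : ∀ i, 0 < v i)
    (hd : 0 < d) {z : EuclideanSpace ℝ (Fin d)} (hz : H z = z) {p α K ξ : ℝ} (hp : 1 < p)
    (hα : 0 < α) (hK : 0 < K) (hξ : ξ ∉ Set.Ioc (1 / p) 1) :
    ∃ (Ω : Type u) (_ : MeasurableSpace Ω) (μ : Measure Ω) (_ : IsProbabilityMeasure μ)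
      (x w : ℕ → Ω → EuclideanSpace ℝ (Fin d)) (hx : ∀ k, StronglyMeasurable (x k)),
      IsStochasticApproximation H (fun k => α * ((k : ℝ) + K) ^ (-ξ)) x w ∧
      UnbiasedNoise μ (Filtration.natural x hx) w ∧
      MomentNoise μ (Filtration.natural x hx) p z x w ∧
      ¬ ∀ᵐ ω ∂μ, Tendsto (fun k => x k ω) atTop (𝓝 z) := by
  have hp0 : 0 < p := by linarith
  have hs0 := step_pos hα hK ξ
  rcases lt_or_ge 1 ξ with h1 | h1
  · have hsum := (summable_step_iff hα hK ξ).2 h1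
    have htail := tendsto_sum_nat_add (fun k : ℕ => α * ((k : ℝ) + K) ^ (-ξ))
    -- `1/4` because the loss per step is `2 s k` and the total loss may be at most `1/2`.
    obtain ⟨n, hn⟩ := eventually_atTop.1 (htail.eventually_le_const (show (0 : ℝ) < 1 / 4 by norm_num))
    refine hH.exists_not_tendsto_of_expanding hv hd hz hp0 hs0
      (δ := fun k => 2 * (α * ((k : ℝ) + K) ^ (-ξ))) (fun k => by have := hs0 k; positivity) n
      (fun N => ?_) fun k _ x => hH.sub_le_norm_weightScale_step hv hz (hs0 k).le x
    have h2 := ((summable_nat_add_iff (n + 1)).2 hsum).sum_le_tsum (Finset.range N)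
      fun k _ => (hs0 (k + (n + 1))).le
    have h3 := h2.trans (hn (n + 1) n.le_succ)
    rw [← Finset.mul_sum]
    have h4 : ∑ k ∈ Finset.range N, α * (((n + 1 + k : ℕ) : ℝ) + K) ^ (-ξ) =
        ∑ k ∈ Finset.range N, α * (((k + (n + 1) : ℕ) : ℝ) + K) ^ (-ξ) :=
      Finset.sum_congr rfl fun k _ => by rw [add_comm k]
    rw [h4]
    linarith
  rcases lt_or_ge ξ 0 with h0 | h0
  · have hγ : 0 < 1 - γ := sub_pos.2 hH.lt_one
    have hlim : Tendsto (fun k : ℕ => α * ((k : ℝ) + K) ^ (-ξ)) atTop atTop :=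
      ((tendsto_rpow_atTop (neg_pos.2 h0)).comp (tendsto_natCast_add_atTop K)).const_mul_atTop hα
    obtain ⟨n, hn⟩ := eventually_atTop.1 (hlim.eventually_ge_atTop (2 / (1 - γ)))
    refine hH.exists_not_tendsto_of_expanding hv hd hz hp0 hs0 (δ := fun _ => 0) (fun _ => le_rfl) n
      (fun N => by simp) fun k hk x => ?_
    rw [sub_zero, one_mul]
    exact hH.le_norm_weightScale_step hv hz ((div_le_iff₀ hγ).1 (hn k hk.le)) x
  · have hξp : ξ ≤ 1 / p := by
      by_contra hcon
      exact hξ ⟨not_le.1 hcon, h1⟩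
    -- For `ξ ≥ 0` the steps do not increase, so the step at time `0` bounds them all.
    refine hH.exists_not_tendsto_of_not_summable hv hd hz hp0 hs0 (b := α * K ^ (-ξ)) (fun k => ?_)
      fun hsum => ?_
    · refine mul_le_mul_of_nonneg_left ?_ hα.le
      exact Real.rpow_le_rpow_of_nonpos hK (le_add_of_nonneg_left k.cast_nonneg) (by linarith)
    · have := (summable_step_rpow_iff hα hK ξ p).1 hsum
      rw [le_div_iff₀ hp0] at hξp
      linarith

end IsWeightedContraction

/-! ### The main theorem -/

theorem corollary3 {d : ℕ} (hd : 0 < d)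
    (v : Fin d → ℝ) (hv : ∀ i, 0 < v i) (γ : ℝ)
    (H : EuclideanSpace ℝ (Fin d) → EuclideanSpace ℝ (Fin d))
    (hH : IsWeightedContraction v γ H)
    (p : ℝ) (hp : 1 < p) (α K : ℝ) (hα : 0 < α) (hK : 0 < K) :
    ∃ xstar : EuclideanSpace ℝ (Fin d),
      H xstar = xstar ∧ (∀ y, H y = y → y = xstar) ∧
      NegativeDrift H xstar (fun x => weightedNorm v x ^ 2) (1 - γ ^ 2) ∧
      ∀ ξ : ℝ,
        (∀ (Ω : Type u) [MeasurableSpace Ω] (μ : Measure Ω) [IsProbabilityMeasure μ]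
            (x w : ℕ → Ω → EuclideanSpace ℝ (Fin d)) (hx : ∀ k, StronglyMeasurable (x k)),
            IsStochasticApproximation H (fun k => α * ((k : ℝ) + K) ^ (-ξ)) x w →
            UnbiasedNoise μ (Filtration.natural x hx) w →
            MomentNoise μ (Filtration.natural x hx) p xstar x w →
            ∀ᵐ ω ∂μ, Tendsto (fun k => x k ω) atTop (𝓝 xstar)) ↔
          ξ ∈ Set.Ioc (1 / p) 1 := by
  obtain ⟨z, hz, huniq⟩ := hH.exists_fixedPoint hv
  refine ⟨z, hz, huniq, hH.negativeDrift hv hz, fun ξ => ⟨fun h => ?_, fun hξ => ?_⟩⟩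
  · by_contra hξ
    obtain ⟨Ω, mΩ, μ, hμ, x, w, hx, hsa, hub, hmom, hnot⟩ :=
      hH.exists_not_tendsto_of_notMem_Ioc.{u} hv hd hz hp hα hK hξ
    exact hnot (h Ω μ x w hx hsa hub hmom)
  · intro Ω _ μ _ x w hx hsa hub hmom
    exact hH.ae_tendsto_of_mem_Ioc hv hz hp hα hK hξ μ x w hx hsa hub hmom
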